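/- Let $K$ be a field, $S=K[x_0,\dots,x_n]$ with its standard grading, and let $f_0,\dots,f_n\in S$ be homogeneous of degrees $d_0,\dots,d_n$. Put $J=(f_0,\dots,f_n)$ and $W=(f_1,\dots,f_n)$, and assume that $\dim S/J=1$ and that $f_1,\dots,f_n$ is a regular sequence in $S$. Let $I=(J:\mathfrak m^\infty)$, with $\mathfrak m=(x_0,\dots,x_n)$, be the saturation of $J$, and let $s=\sum_{i=1}^n d_i-n-1$. Let $AR(\mathbf f)=\{(a_0,\dots,a_n)\in S^{n+1} : \sum_{i=0}^n a_if_i=0\}$ be the module of relations, graded so that $AR(\mathbf f)_m$ consists of the relations in which every $a_i$ is homogeneous of degree $m-d_i$ (so $a_i=0$ if $m<d_i$); let $KR(\mathbf f)\subseteq AR(\mathbf f)$ be the submodule spanned by the Koszul relations $t_{ij}$, $0\le i<j\le n$, where $t_{ij}$ has $i$-th coordinate $f_j$, $j$-th coordinate $-f_i$ and all other coordinates $0$; and let $ER(\mathbf f)=AR(\mathbf f)/KR(\mathbf f)$ with the induced grading. A relation is called nontrivial if it does not lie in $KR(\mathbf f)$. 1. The map $(a_0,\dots,a_n)\mapsto[a_0]$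 induces an isomorphism of graded $S$-modules from $ER(\mathbf f)$ onto the kernel of multiplication by $f_0$ on $S/W$, where, for every $j\in\mathbb Z$, the piece $ER(\mathbf f)_{j+d_0}$ is mapped onto $\ker\{(S/W)_j\xrightarrow{f_0}(S/W)_{j+d_0}\}$. 2. There is a polynomial $F\in\mathbb Z[t]$ with $F(1)\ne0$ such that the Hilbert series of $S/I$ is $\sum_{p\ge0}\dim_K(S/I)_p\,t^p=F/(1-t)$ (clearly $F$ is unique), and for this $F$: (a) the map $(S/W)_j\xrightarrow{f_0}(S/W)_{j+d_0}$ is injective for every integer $j\le s-\deg F$, and it is not injective for $j=s-\deg F+1$; (b) the minimal degree $m$ of a nontrivial homogeneous relation, that is the least $m\in\mathbb Z$ such that some element of $AR(\mathbf f)_m$ is nontrivial, is $m=\sum_{i=0}^n d_i-n-\deg F$. -/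

import Mathlib

namespace ACI

open MvPolynomial

noncomputable section

variable (K : Type*) [Field K] (n : ℕ)

/-- The polynomial ring `S = K[x_0, …, x_n]`. -/
abbrev S : Type _ := MvPolynomial (Fin (n + 1)) K

/-- The space `S_j` of forms of degree `j`, for an integer `j`, every variable having degree `1`
(so `S_j = 0` for `j < 0`). -/
def forms (j : ℤ) : Submodule K (S K n) :=
  weightedHomogeneousSubmodule K (fun _ : Fin (n + 1) => (1 : ℤ)) j

variable {K n}

theorem mem_forms_iff {j : ℤ} {g : S K n} :
    g ∈ forms K n j ↔ ∀ u : Fin (n + 1) →₀ ℕ, coeff u g ≠ 0 → (u.degree : ℤ) = j := by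
  have key (u : Fin (n + 1) →₀ ℕ) :
      Finsupp.weight (fun _ : Fin (n + 1) => (1 : ℤ)) u = (u.degree : ℤ) := by
    simp [Finsupp.weight_apply, Finsupp.degree_apply, Finsupp.sum]
  simp only [forms, mem_weightedHomogeneousSubmodule, IsWeightedHomogeneous, key]

theorem mem_forms_natCast {k : ℕ} {g : S K n} :
    g ∈ forms K n (k : ℤ) ↔ g.IsHomogeneous k := by
  rw [mem_forms_iff]
  simp only [IsHomogeneous, IsWeightedHomogeneous, Nat.cast_inj]
  have key (u : Fin (n + 1) →₀ ℕ) : Finsupp.weight (1 : Fin (n + 1) → ℕ) u = u.degree := by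
    rw [Finsupp.degree_eq_weight_one]
    rfl
  simp only [key]

theorem mul_mem_forms {i j : ℤ} {g h : S K n} (hg : g ∈ forms K n i) (hh : h ∈ forms K n j) :
    g * h ∈ forms K n (i + j) :=
  IsWeightedHomogeneous.mul hg hh

/-- The graded piece `(S/Q)_j`: the classes in `S/Q` of the forms of degree `j`. -/
def quotPiece (Q : Ideal (S K n)) (j : ℤ) : Submodule K (S K n ⧸ Q) :=
  (forms K n j).map (Ideal.Quotient.mkₐ K Q).toLinearMap

/-- Multiplication by a form `g` of degree `k`, as a map `(S/Q)_j → (S/Q)_{j+k}`. -/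
def mulForm (Q : Ideal (S K n)) {g : S K n} {k : ℕ} (hg : g.IsHomogeneous k) (j : ℤ) :
    quotPiece Q j →ₗ[K] quotPiece Q (j + k) :=
  (LinearMap.mulLeft K (Ideal.Quotient.mk Q g)).restrict (by
    rintro _ ⟨h, hh, rfl⟩
    refine ⟨g * h, ?_, by simp⟩
    exact add_comm (k : ℤ) j ▸ mul_mem_forms (mem_forms_natCast.2 hg) hh)

/-- Multiplication by `g` on `S/Q`, as an `S`-linear map. -/
def mulQuot (Q : Ideal (S K n)) (g : S K n) : (S K n ⧸ Q) →ₗ[S K n] (S K n ⧸ Q) :=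
  LinearMap.lsmul (S K n) (S K n ⧸ Q) g

/-- The homogeneous maximal ideal `(x_0, …, x_n)`. -/
def irrelevant (K : Type*) [Field K] (n : ℕ) : Ideal (S K n) :=
  Ideal.span (Set.range (X : Fin (n + 1) → S K n))

/-- The saturation `(Q : m^∞)`, i.e. the union of the `(Q : m^k)`, where `m = (x_0, …, x_n)`. -/
def saturation (Q : Ideal (S K n)) : Ideal (S K n) where
  carrier := {g | ∃ k : ℕ, ∀ h ∈ irrelevant K n ^ k, g * h ∈ Q}
  zero_mem' := ⟨0, fun h _ => by simp⟩
  add_mem' := by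
    rintro a b ⟨k, hk⟩ ⟨l, hl⟩
    refine ⟨k + l, fun h hh => ?_⟩
    rw [add_mul]
    exact Q.add_mem (hk h (Ideal.pow_le_pow_right (Nat.le_add_right k l) hh))
      (hl h (Ideal.pow_le_pow_right (Nat.le_add_left l k) hh))
  smul_mem' := by
    rintro c a ⟨k, hk⟩
    refine ⟨k, fun h hh => ?_⟩
    rw [smul_eq_mul, mul_assoc]
    exact Q.mul_mem_left c (hk h hh)

/-- The Hilbert series `∑_p dim_K (S/Q)_p t^p`. -/
def hilbertSeries (Q : Ideal (S K n)) : PowerSeries ℤ :=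
  PowerSeries.mk fun p : ℕ => (Module.finrank K (quotPiece Q (p : ℤ)) : ℤ)

/-- The ideal `J = (f_0, f_1, …, f_n)`. -/
def idealJ (f : Fin (n + 1) → S K n) : Ideal (S K n) :=
  Ideal.span (Set.range f)

/-- The ideal `W = (f_1, …, f_n)`. -/
def idealW (f : Fin (n + 1) → S K n) : Ideal (S K n) :=
  Ideal.span (Set.range fun i : Fin n => f i.succ)

/-- The module `AR(f)` of all relations `a_0 f_0 + … + a_n f_n = 0`. -/
def AR (f : Fin (n + 1) → S K n) : Submodule (S K n) (Fin (n + 1) → S K n) :=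
  LinearMap.ker (Fintype.linearCombination (S K n) f)

theorem mem_AR {f a : Fin (n + 1) → S K n} : a ∈ AR f ↔ ∑ i, a i * f i = 0 := by
  simp [AR, Fintype.linearCombination_apply]

/-- The Koszul relation with `i`-th coordinate `f_j`, `j`-th coordinate `-f_i` (for `i ≠ j`) and
the other coordinates zero. -/
def koszulRel (f : Fin (n + 1) → S K n) (i j : Fin (n + 1)) : Fin (n + 1) → S K n :=
  Pi.single i (f j) - Pi.single j (f i)

/-- The module `KR(f)` of Koszul (trivial) relations. -/
def KR (f : Fin (n + 1) → S K n) : Submodule (S K n) (Fin (n + 1) → S K n) :=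
  Submodule.span (S K n) {a | ∃ i j, i < j ∧ a = koszulRel f i j}

theorem KR_le_AR (f : Fin (n + 1) → S K n) : KR f ≤ AR f := by
  refine Submodule.span_le.2 ?_
  rintro _ ⟨i, j, -, rfl⟩
  rw [SetLike.mem_coe, mem_AR]
  simp only [koszulRel, Pi.sub_apply, sub_mul, Finset.sum_sub_distrib, Pi.single_apply, ite_mul,
    zero_mul, Finset.sum_ite_eq', Finset.mem_univ, if_true]
  ring

/-- The module `ER(f) = AR(f)/KR(f)` of essential relations. -/
abbrev ER (f : Fin (n + 1) → S K n) : Type _ := AR f ⧸ (KR f).submoduleOf (AR f)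

/-- `AR(f)_m`: the relations `a` such that every `a_i` is a form of degree `m - d_i`. -/
def ARpiece (d : Fin (n + 1) → ℕ) (f : Fin (n + 1) → S K n) (m : ℤ) : Set (AR f) :=
  {a | ∀ i, a.1 i ∈ forms K n (m - d i)}

/-- `ER(f)_m`: the classes of the elements of `AR(f)_m`. -/
def ERpiece (d : Fin (n + 1) → ℕ) (f : Fin (n + 1) → S K n) (m : ℤ) : Set (ER f) :=
  ((KR f).submoduleOf (AR f)).mkQ '' ARpiece d f m

/-- The `j`-th graded piece of `ker (f_0 : S/W → (S/W)(d_0))`. -/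
def kerPiece (f : Fin (n + 1) → S K n) (j : ℤ) :
    Set (LinearMap.ker (mulQuot (idealW f) (f 0))) :=
  {b | (b : S K n ⧸ idealW f) ∈ quotPiece (idealW f) j}

end

end ACI

namespace ACI

open MvPolynomial

noncomputable section

variable {K : Type*} [Field K] {n : ℕ}

/-! A relation gives `f 0 * a 0 ∈ W`, and every solution of this congruence extends to a relation.
If `a 0 ∈ W`, subtracting Koszul relations makes `a 0` vanish; what remains is a relation of the
regular sequence `f_1, …, f_n`, hence Koszul. So `mem_KR_iff` turns everything into a question about
the annihilator of `f_0` in `S/W`.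

This annihilator is governed by the saturation `I`. As `S/W` has positive depth (`IsRegSeq.isSat`),
`W : f_0 = W : I` (`mul_mem_iff_forall_saturation`). Choose a form `l` of large degree `e`, a
nonzerodivisor modulo `W` and modulo `I`. Then `W + (l)` is generated by a regular sequence of `n +
1` forms, and its residue ring has a one-dimensional socle, in degree `s + e`. The resulting perfect
pairing (`IsRegSeq.annihilator_iff`) shows that the annihilator of `I + (l)` vanishes in degree `j`
iff `S/(I + (l))` vanishes in degree `s + e - j`, that is, iff the Hilbert function of `S/I` agrees
at `s + e - j` and `s - j`. For large `e` the form `l` is invisible on the annihilator side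
(`IsRegSeq.link_iff`).

Hence `f_0` is injective in degree `j` iff the Hilbert function of `S/I` has its eventual value at
`s - j`. That value is taken from `deg F` on and not at `deg F - 1`, which gives (a); shifting by
`d_0` gives (b).

The socle and depth statements come from Rees' isomorphism `Hom(S/m, S/(g)) ≃ Ext^r(S/m, S)`: the
right side depends only on the length of `g`, so `g` may be compared with the variables. Using forms
`l` of large degree instead of linear ones keeps the argument valid over finite fields. -/

/-! ### Homogeneous components and homogeneous ideals -/

instance formsGradedAlgebra : GradedAlgebra (forms K n) :=
  weightedGradedAlgebra K (fun _ : Fin (n + 1) => (1 : ℤ))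

/-- The component of degree `j` of a polynomial, for an integer `j`. -/
def comp (j : ℤ) : S K n →ₗ[K] S K n := GradedAlgebra.proj (forms K n) j

theorem comp_apply (j : ℤ) (g : S K n) :
    comp j g = (DirectSum.decompose (forms K n) g j : S K n) := rfl

theorem comp_mem (j : ℤ) (g : S K n) : comp j g ∈ forms K n j :=
  (DirectSum.decompose (forms K n) g j).2

theorem comp_of_mem {j : ℤ} {g : S K n} (hg : g ∈ forms K n j) : comp j g = g :=
  DirectSum.decompose_of_mem_same _ hg

theorem comp_mul {i : ℤ} {h : S K n} (hh : h ∈ forms K n i) (j : ℤ) (g : S K n) :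
    comp j (g * h) = comp (j - i) g * h := by
  have := DirectSum.coe_decompose_mul_add_of_right_mem (𝒜 := forms K n) (a := g) (i := j - i) hh
  rwa [sub_add_cancel] at this

theorem forms_of_neg {j : ℤ} (hj : j < 0) {g : S K n} (hg : g ∈ forms K n j) : g = 0 := by
  by_contra h
  obtain ⟨u, hu⟩ := ne_zero_iff.1 h
  have := mem_forms_iff.1 hg u hu
  omega

theorem X_mem_forms (i : Fin (n + 1)) : (X i : S K n) ∈ forms K n 1 :=
  mem_forms_natCast.2 (isHomogeneous_X K i)

theorem one_mem_forms : (1 : S K n) ∈ forms K n 0 :=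
  mem_forms_natCast.2 (isHomogeneous_one _ K)

instance finite_forms (j : ℤ) : Module.Finite K (forms K n j) := by
  have hle : forms K n j ≤ restrictTotalDegree (Fin (n + 1)) K j.toNat := by
    intro g hg
    rw [mem_restrictTotalDegree]
    refine Finset.sup_le fun u hu => ?_
    have := mem_forms_iff.1 hg u (mem_support_iff.1 hu)
    have h2 : u.degree = (u.sum fun _ e => e) := rfl
    omega
  exact Submodule.finiteDimensional_of_le hle

/-- Homogeneous ideals of `S`. -/
abbrev Homog (Q : Ideal (S K n)) : Prop := Q.IsHomogeneous (forms K n)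

theorem Homog.comp_mem {Q : Ideal (S K n)} (hQ : Homog Q) (j : ℤ) {g : S K n} (hg : g ∈ Q) :
    comp j g ∈ Q := hQ j hg

theorem mem_of_comp_mem {Q : Ideal (S K n)} {g : S K n} (h : ∀ j, comp j g ∈ Q) : g ∈ Q := by
  classical
  rw [← DirectSum.sum_support_decompose (forms K n) g]
  exact Q.sum_mem fun j _ => h j

theorem Homog.of_comp_mem {Q : Ideal (S K n)} (h : ∀ j, ∀ g ∈ Q, comp j g ∈ Q) : Homog Q :=
  fun j _ hg => h j _ hg

theorem homog_span {A : Set (S K n)} (h : ∀ a ∈ A, ∃ j, a ∈ forms K n j) : Homog (Ideal.span A) :=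
  Ideal.homogeneous_span _ _ h

theorem homog_span_singleton {l : S K n} {e : ℤ} (hl : l ∈ forms K n e) :
    Homog (Ideal.span {l}) :=
  homog_span fun _ ha => ⟨e, by rwa [Set.mem_singleton_iff.1 ha]⟩

theorem mk_mem_quotPiece {Q : Ideal (S K n)} {j : ℤ} {g : S K n} (hg : g ∈ forms K n j) :
    Ideal.Quotient.mk Q g ∈ quotPiece Q j := ⟨g, hg, rfl⟩

theorem exists_of_mem_quotPiece {Q : Ideal (S K n)} {j : ℤ} {b : S K n ⧸ Q}
    (hb : b ∈ quotPiece Q j) : ∃ g ∈ forms K n j, Ideal.Quotient.mk Q g = b := hb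

instance finite_quotPiece (Q : Ideal (S K n)) (j : ℤ) : Module.Finite K (quotPiece Q j) :=
  inferInstanceAs (Module.Finite K ((forms K n j).map _))

/-! ### Hilbert functions and division by a nonzerodivisor -/

/-- The Hilbert function of `S/Q`, as a function on the integers. -/
def hilb (Q : Ideal (S K n)) (j : ℤ) : ℕ := Module.finrank K (quotPiece Q j)

theorem hilb_eq_zero_iff {Q : Ideal (S K n)} {j : ℤ} :
    hilb Q j = 0 ↔ ∀ g ∈ forms K n j, g ∈ Q := by
  rw [hilb, Submodule.finrank_eq_zero, Submodule.eq_bot_iff]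
  constructor
  · intro h g hg
    exact Ideal.Quotient.eq_zero_iff_mem.1 (h _ (mk_mem_quotPiece hg))
  · rintro h _ ⟨g, hg, rfl⟩
    exact Ideal.Quotient.eq_zero_iff_mem.2 (h g hg)

theorem hilb_of_neg (Q : Ideal (S K n)) {j : ℤ} (hj : j < 0) : hilb Q j = 0 :=
  hilb_eq_zero_iff.2 fun g hg => by rw [forms_of_neg hj hg]; exact Q.zero_mem

theorem hilb_eq_zero_of_le {Q I : Ideal (S K n)} (hQI : Q ≤ I) {j : ℤ} (h : hilb Q j = 0) :
    hilb I j = 0 :=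
  hilb_eq_zero_iff.2 fun g hg => hQI (hilb_eq_zero_iff.1 h g hg)

/-- `l` is a nonzerodivisor modulo `Q`. -/
def NZD {R : Type*} [CommRing R] (Q : Ideal R) (l : R) : Prop := ∀ p, l * p ∈ Q → p ∈ Q

/-- Dimension count in the exact sequence `0 → (S/Q)_j → (S/Q)_{j+e} → (S/(Q + (l)))_{j+e} → 0`,
whose first map is multiplication by `l`. -/
theorem hilb_sup_span {Q : Ideal (S K n)} (hQ : Homog Q) {l : S K n} {e : ℕ}
    (hl : l ∈ forms K n e) (hnz : NZD Q l) (j : ℤ) :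
    hilb (Q ⊔ Ideal.span {l}) (j + e) + hilb Q j = hilb Q (j + e) := by
  let μ := mulForm Q (mem_forms_natCast.1 hl) j
  have hle : Q ≤ Q ⊔ Ideal.span {l} := le_sup_left
  let π₀ : (S K n ⧸ Q) →ₗ[K] (S K n ⧸ (Q ⊔ Ideal.span {l})) :=
    (Ideal.Quotient.factorₐ K hle).toLinearMap
  have hπ₀ (g : S K n) : π₀ (Ideal.Quotient.mk Q g) = Ideal.Quotient.mk _ g := rfl
  let π : quotPiece Q (j + e) →ₗ[K] quotPiece (Q ⊔ Ideal.span {l}) (j + e) :=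
    π₀.restrict (by rintro _ ⟨g, hg, rfl⟩; exact ⟨g, hg, rfl⟩)
  have hμ (g : S K n) (hg : g ∈ forms K n j) :
      ((μ ⟨_, mk_mem_quotPiece hg⟩ : quotPiece Q (j + e)) : S K n ⧸ Q) =
        Ideal.Quotient.mk Q (l * g) := by
    simp [μ, mulForm]
  have hinj : Function.Injective μ := by
    rw [← LinearMap.ker_eq_bot, LinearMap.ker_eq_bot']
    rintro ⟨_, g, hg, rfl⟩ h
    have h2 := (hμ g hg).symm.trans (congrArg Subtype.val h)
    exact Subtype.ext (Ideal.Quotient.eq_zero_iff_mem.2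
      (hnz g (Ideal.Quotient.eq_zero_iff_mem.1 h2)))
  have hsurj : Function.Surjective π := by
    rintro ⟨_, g, hg, rfl⟩
    exact ⟨⟨_, mk_mem_quotPiece hg⟩, rfl⟩
  have hex : LinearMap.ker π = LinearMap.range μ := by
    ext ⟨b, hb⟩
    obtain ⟨g, hg, rfl⟩ := exists_of_mem_quotPiece hb
    have hk : (⟨Ideal.Quotient.mk Q g, hb⟩ : quotPiece Q (j + e)) ∈ LinearMap.ker π ↔
        g ∈ Q ⊔ Ideal.span {l} := by
      rw [LinearMap.mem_ker, ← Ideal.Quotient.eq_zero_iff_mem, ← hπ₀]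
      exact Subtype.ext_iff
    rw [hk]
    constructor
    · intro h
      obtain ⟨q, hq, r, hr, hqr⟩ := Submodule.mem_sup.1 h
      obtain ⟨c, rfl⟩ := Ideal.mem_span_singleton'.1 hr
      -- The cofactor `c` need not be homogeneous; since `Q` is, its component of degree `j` serves
      -- as well.
      refine ⟨⟨_, mk_mem_quotPiece (comp_mem j c)⟩, Subtype.ext ?_⟩
      rw [hμ _ (comp_mem j c)]
      change _ = Ideal.Quotient.mk Q g
      rw [Ideal.Quotient.mk_eq_mk_iff_sub_mem, ← comp_of_mem hg, ← hqr, map_add, comp_mul hl,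
        add_sub_cancel_right]
      convert Q.neg_mem (hQ.comp_mem (j + e) hq) using 1
      ring
    · rintro ⟨⟨_, c, hc, rfl⟩, h⟩
      have h2 : Ideal.Quotient.mk Q (l * c) = Ideal.Quotient.mk Q g :=
        (hμ c hc).symm.trans (congrArg Subtype.val h)
      rw [Ideal.Quotient.mk_eq_mk_iff_sub_mem] at h2
      have h3 : g = -(l * c - g) + c * l := by ring
      rw [h3]
      exact Ideal.add_mem _ (hle (Q.neg_mem h2))
        (Ideal.mem_sup_right (Ideal.mem_span_singleton'.2 ⟨c, rfl⟩))
  have h1 := π.finrank_range_add_finrank_ker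
  rw [hex, LinearMap.finrank_range_of_inj hinj, LinearMap.range_eq_top.2 hsurj, finrank_top] at h1
  exact h1

/-! ### Regular sequences in terms of ideals -/

/-- Weakly regular sequences in a commutative ring, spelled out with ideals. -/
def IsRegSeq {R : Type*} [CommRing R] {r : ℕ} (g : Fin r → R) : Prop :=
  ∀ i, NZD (Ideal.span (g '' Set.Iio i)) (g i)

section CommRing

variable {R : Type*} [CommRing R]

theorem isSMulRegular_quotient_iff (I : Ideal R) (r : R) :
    IsSMulRegular (R ⧸ (I • ⊤ : Submodule R R)) r ↔ NZD I r := by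
  have h : (I • ⊤ : Submodule R R) = I := by rw [smul_eq_mul, Ideal.mul_top]
  rw [h, isSMulRegular_iff_right_eq_zero_of_smul]
  constructor
  · intro H p hp
    refine Ideal.Quotient.eq_zero_iff_mem.1 (H (Ideal.Quotient.mk I p) ?_)
    rwa [← Ideal.Quotient.mk_eq_mk, ← Submodule.Quotient.mk_smul,
      Submodule.Quotient.mk_eq_zero]
  · intro H b hb
    obtain ⟨p, rfl⟩ := Ideal.Quotient.mk_surjective b
    refine Ideal.Quotient.eq_zero_iff_mem.2 (H p ?_)
    rwa [← Ideal.Quotient.mk_eq_mk, ← Submodule.Quotient.mk_smul,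
      Submodule.Quotient.mk_eq_zero] at hb

theorem ofList_take_ofFn {r : ℕ} (g : Fin r → R) (i : Fin r) :
    Ideal.ofList ((List.ofFn g).take i) = Ideal.span (g '' Set.Iio i) := by
  rw [Ideal.ofList]
  congr 1
  ext a
  simp only [Set.mem_ofPred_eq, List.mem_take_iff_getElem, List.getElem_ofFn, Set.mem_image,
    Set.mem_Iio, List.length_ofFn]
  constructor
  · rintro ⟨k, hk, rfl⟩
    exact ⟨⟨k, by omega⟩, by simp only [Fin.lt_def]; omega, rfl⟩
  · rintro ⟨k, hk, rfl⟩
    exact ⟨k, by rw [Fin.lt_def] at hk; omega, rfl⟩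

theorem ofList_ofFn {r : ℕ} (g : Fin r → R) :
    Ideal.ofList (List.ofFn g) = Ideal.span (Set.range g) := by
  rw [Ideal.ofList]
  congr 1
  ext a
  simp

theorem isWeaklyRegular_ofFn_iff {r : ℕ} (g : Fin r → R) :
    RingTheory.Sequence.IsWeaklyRegular R (List.ofFn g) ↔ IsRegSeq g := by
  rw [RingTheory.Sequence.isWeaklyRegular_iff]
  constructor
  · intro h i
    rw [← ofList_take_ofFn, ← isSMulRegular_quotient_iff]
    simpa using h i (by simp)
  · intro h i hi
    have hi' : i < r := by simpa using hi
    have := h ⟨i, hi'⟩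
    rw [← ofList_take_ofFn, ← isSMulRegular_quotient_iff] at this
    simpa using this

end CommRing

/-- Membership in a monomial ideal is tested on exponents, and multiplying by `X i` leaves the
exponents of the earlier variables unchanged. -/
theorem isRegSeq_X (K : Type*) [Field K] (n : ℕ) : IsRegSeq (X : Fin (n + 1) → S K n) := by
  intro i p hp
  rw [mem_ideal_span_X_image] at hp ⊢
  intro u hu
  have hu' : u + Finsupp.single i 1 ∈ (X i * p).support := by
    have h := coeff_X_mul u i p
    rw [mem_support_iff, add_comm u, h]
    exact mem_support_iff.1 hu
  obtain ⟨k, hk, hk'⟩ := hp _ hu'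
  refine ⟨k, hk, ?_⟩
  have : i ≠ k := ne_of_gt hk
  simpa [Finsupp.single_apply, this] using hk'

/-! ### Rees' isomorphism -/

section Ext

open CategoryTheory Abelian RingTheory.Sequence

universe u

variable {R : Type u} [CommRing R]

/-- Rees' isomorphism, one step: if `a` is regular on `M`, kills `N`, and `Ext^i(N, M) = 0`, then
`Ext^i(N, M/aM)` and `Ext^{i+1}(N, M)` are isomorphic. -/
theorem nonempty_ext_quotSMulTop_equiv (N M : ModuleCat.{u} R) {a : R}
    (ha : a ∈ Module.annihilator R N) (hreg : IsSMulRegular M a) (i : ℕ)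
    (h0 : Subsingleton (Ext N M i)) :
    Nonempty (Ext N (ModuleCat.of R (QuotSMulTop a M)) i ≃ₗ[R] Ext N M (i + 1)) := by
  have hS := hreg.smulShortComplex_shortExact
  let δ : Ext N (ModuleCat.of R (QuotSMulTop a M)) i →ₗ[R] Ext N M (i + 1) :=
    Ext.postcompOfLinear hS.extClass R N rfl
  refine ⟨LinearEquiv.ofBijective δ ⟨?_, ?_⟩⟩
  · rw [← LinearMap.ker_eq_bot, LinearMap.ker_eq_bot']
    intro x hx
    obtain ⟨y, rfl⟩ := Ext.covariant_sequence_exact₃ N hS x rfl hx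
    have hy : y = 0 := Subsingleton.elim (α := Ext N M i) _ _
    rw [hy, Ext.zero_comp]
    rfl
  -- The next map in the long exact sequence is multiplication by `a` on `Ext^{i+1}(N, M)`, which is
  -- zero because `a` kills `N`.
  · intro y
    refine Ext.covariant_sequence_exact₁ N hS y ?_ rfl
    have := Ext.postcomp_smul_id_eq_zero_of_mem_annihilator (M := M) ha (i + 1)
    exact congrArg (fun f => f.hom y) this

theorem smul_top_quotSMulTop_lt_top {M : Type*} [AddCommGroup M] [Module R M] {I : Ideal R} {a : R}
    (ha : a ∈ I) (hlt : I • (⊤ : Submodule R M) < ⊤) :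
    I • (⊤ : Submodule R (QuotSMulTop a M)) < ⊤ := by
  refine lt_top_iff_ne_top.2 fun h => hlt.ne ?_
  have h2 := congrArg (Submodule.comap (Submodule.mkQ _)) h
  simpa [Submodule.comap_smul_top_of_surjective I _ (Submodule.mkQ_surjective _),
    Submodule.smul_mono_left ((Ideal.span_singleton_le_iff_mem I).mpr ha),
    ← Submodule.ideal_span_singleton_smul] using h2

/-- Postcomposition with a linear equivalence, as a linear equivalence of spaces of maps. -/
def homCongrRight {N M M' : Type*} [AddCommGroup N] [Module R N] [AddCommGroup M] [Module R M]
    [AddCommGroup M'] [Module R M'] (e : M ≃ₗ[R] M') : (N →ₗ[R] M) ≃ₗ[R] (N →ₗ[R] M') :=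
  LinearEquiv.arrowCongr (LinearEquiv.refl R N) e

/-- Each element of the sequence trades a quotient of `M` for one higher Ext degree, by
`nonempty_ext_quotSMulTop_equiv`. -/
theorem nonempty_ext_equiv_hom [IsNoetherianRing R] (I : Ideal R) (rs : List R)
    (hI : ∀ r ∈ rs, r ∈ I) (N : Type u) [AddCommGroup N] [Module R N] [Module.Finite R N]
    (hN : I ≤ Module.annihilator R N) (M : Type u) [AddCommGroup M] [Module R M]
    [Module.Finite R M] (hlt : I • (⊤ : Submodule R M) < ⊤) (hreg : IsRegular M rs) :
    Nonempty ((N →ₗ[R] (M ⧸ (Ideal.ofList rs • ⊤ : Submodule R M))) ≃ₗ[R]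
      Ext (ModuleCat.of R N) (ModuleCat.of R M) rs.length) := by
  induction rs generalizing M with
  | nil =>
    let e : M ≃ₗ[R] (M ⧸ (Ideal.ofList ([] : List R) • ⊤ : Submodule R M)) :=
      (Submodule.quotEquivOfEqBot _ (by simp)).symm
    let e2 : (ModuleCat.of R N ⟶ ModuleCat.of R M) ≃ₗ[R] (N →ₗ[R] M) :=
      ModuleCat.homLinearEquiv (S := R)
    exact ⟨(homCongrRight e).symm.trans (e2.symm.trans
      (Ext.linearEquiv₀ (R := R) (X := ModuleCat.of R N) (Y := ModuleCat.of R M)).symm)⟩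
  | cons a rs ih =>
    have hmem : ∀ r ∈ rs, r ∈ I := fun r hr => hI r (List.mem_cons_of_mem _ hr)
    have ha := hI a List.mem_cons_self
    have hreg' := (isRegular_cons_iff M a rs).1 hreg
    obtain ⟨e1⟩ := ih hmem (QuotSMulTop a M) (smul_top_quotSMulTop_lt_top ha hlt) hreg'.2
    -- `N` is supported on `V(I)`, and `a :: rs` is a regular sequence in `I` longer than the Ext
    -- degree.
    have h0 : Subsingleton (Ext (ModuleCat.of R N) (ModuleCat.of R M) rs.length) := by
      refine ModuleCat.subsingleton_ext_of_exists_isRegular I (ModuleCat.of R N) ?_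
        (ModuleCat.of R M) hlt (a :: rs) hI hreg _ (by simp)
      rw [Module.support_eq_zeroLocus]
      exact PrimeSpectrum.zeroLocus_anti_mono hN
    obtain ⟨e2⟩ := nonempty_ext_quotSMulTop_equiv (ModuleCat.of R N) (ModuleCat.of R M) (hN ha)
      hreg'.1 rs.length h0
    let e3 := Submodule.quotOfListConsSMulTopEquivQuotSMulTopInner M a rs
    exact ⟨(homCongrRight e3).trans (e1.trans e2)⟩

theorem nonempty_hom_quotient_ofList_equiv_ext [IsNoetherianRing R] {I : Ideal R} (hI : I ≠ ⊤)
    {rs : List R} {r : ℕ} (hr : rs.length = r) (hreg : IsWeaklyRegular R rs)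
    (hmem : ∀ a ∈ rs, a ∈ I) :
    Nonempty (((R ⧸ I) →ₗ[R] (R ⧸ Ideal.ofList rs)) ≃ₗ[R]
      Ext (ModuleCat.of R (R ⧸ I)) (ModuleCat.of R R) r) := by
  have hlt : I • (⊤ : Submodule R R) < ⊤ := by
    rw [smul_eq_mul, Ideal.mul_top]
    exact lt_top_iff_ne_top.2 hI
  have hle : Ideal.ofList rs ≤ I := Ideal.span_le.2 hmem
  have hreg' : IsRegular R rs := by
    exact ⟨hreg, fun h => hlt.ne (top_le_iff.1 (h.le.trans (Submodule.smul_mono_left hle)))⟩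
  have hann : I ≤ Module.annihilator R (R ⧸ I) := by rw [Ideal.annihilator_quotient]
  have he := nonempty_ext_equiv_hom I rs hmem (R ⧸ I) hann R hlt hreg'
  have hq : (Ideal.ofList rs • ⊤ : Submodule R R) = Ideal.ofList rs := by
    rw [smul_eq_mul, Ideal.mul_top]
  let e1 : (R ⧸ Ideal.ofList rs) ≃ₗ[R] (R ⧸ (Ideal.ofList rs • ⊤ : Submodule R R)) :=
    Submodule.quotEquivOfEq _ _ hq.symm
  subst hr
  exact he.map fun e => (homCongrRight e1).trans e

/-- For two regular sequences of the same length in a proper ideal `I`, the submodules of elements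
killed by `I` in the two residue rings are isomorphic. -/
theorem nonempty_hom_quotient_equiv [IsNoetherianRing R] {I : Ideal R} (hI : I ≠ ⊤) {r : ℕ}
    {g h : Fin r → R} (hg : IsRegSeq g) (hh : IsRegSeq h) (hgI : ∀ i, g i ∈ I)
    (hhI : ∀ i, h i ∈ I) :
    Nonempty (((R ⧸ I) →ₗ[R] (R ⧸ Ideal.span (Set.range g))) ≃ₗ[R]
      ((R ⧸ I) →ₗ[R] (R ⧸ Ideal.span (Set.range h)))) := by
  have key (g : Fin r → R) (hg : IsRegSeq g) (hgI : ∀ i, g i ∈ I) :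
      Nonempty (((R ⧸ I) →ₗ[R] (R ⧸ Ideal.span (Set.range g))) ≃ₗ[R]
        Ext (ModuleCat.of R (R ⧸ I)) (ModuleCat.of R R) r) := by
    rw [← ofList_ofFn]
    exact nonempty_hom_quotient_ofList_equiv_ext hI List.length_ofFn
      ((isWeaklyRegular_ofFn_iff g).2 hg) (by simpa [List.mem_ofFn] using hgI)
  obtain ⟨e1⟩ := key g hg hgI
  obtain ⟨e2⟩ := key h hh hhI
  exact ⟨e1.trans e2.symm⟩

end Ext

/-! ### Truncating and extending regular sequences -/

theorem IsRegSeq.castSucc {R : Type*} [CommRing R] {r : ℕ} {g : Fin (r + 1) → R}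
    (hg : IsRegSeq g) : IsRegSeq fun i : Fin r => g i.castSucc := by
  intro i
  have h : (fun i : Fin r => g i.castSucc) '' Set.Iio i = g '' Set.Iio i.castSucc := by
    rw [← Fin.image_castSucc_Iio, Set.image_image]
  rw [h]
  exact hg i.castSucc

theorem range_castSucc_eq_image {α : Type*} {r : ℕ} (g : Fin (r + 1) → α) :
    Set.range (fun i : Fin r => g i.castSucc) = g '' Set.Iio (Fin.last r) := by
  ext a
  constructor
  · rintro ⟨i, rfl⟩
    exact ⟨i.castSucc, Fin.castSucc_lt_last i, rfl⟩
  · rintro ⟨i, hi, rfl⟩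
    exact ⟨i.castPred (ne_of_lt hi), by simp⟩

theorem IsRegSeq.last {R : Type*} [CommRing R] {r : ℕ} {g : Fin (r + 1) → R}
    (hg : IsRegSeq g) : NZD (Ideal.span (Set.range fun i : Fin r => g i.castSucc))
      (g (Fin.last r)) := by
  rw [range_castSucc_eq_image]
  exact hg _

theorem span_range_succ_last {R : Type*} [CommRing R] {r : ℕ} (g : Fin (r + 1) → R) :
    Ideal.span (Set.range g) =
      Ideal.span (Set.range fun i : Fin r => g i.castSucc) ⊔ Ideal.span {g (Fin.last r)} := by
  rw [← Ideal.span_union]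
  congr 1
  ext a
  constructor
  · rintro ⟨i, rfl⟩
    induction i using Fin.lastCases with
    | last => exact Or.inr rfl
    | cast i => exact Or.inl ⟨i, rfl⟩
  · rintro (⟨i, rfl⟩ | h)
    · exact ⟨_, rfl⟩
    · exact ⟨_, (Set.mem_singleton_iff.1 h).symm⟩

theorem IsRegSeq.snoc {R : Type*} [CommRing R] {r : ℕ} {g : Fin r → R}
    (hg : IsRegSeq g) {l : R} (hl : NZD (Ideal.span (Set.range g)) l) :
    IsRegSeq (Fin.snoc g l : Fin (r + 1) → R) := by
  intro i
  induction i using Fin.lastCases with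
  | last =>
    rw [← range_castSucc_eq_image]
    simpa using hl
  | cast i =>
    have h := hg i
    have h2 : (Fin.snoc g l : Fin (r + 1) → R) '' Set.Iio i.castSucc = g '' Set.Iio i := by
      rw [← Fin.image_castSucc_Iio, Set.image_image]
      simp
    rw [h2]
    simpa using h

/-! ### Depth and socle by comparison with the variables -/

theorem mem_irrelevant_iff {p : S K n} :
    p ∈ irrelevant K n ↔ ∀ u ∈ p.support, ∃ i, u i ≠ 0 := by
  rw [irrelevant, ← Set.image_univ, mem_ideal_span_X_image]
  simp

theorem mem_irrelevant_of_mem_forms {p : S K n} {j : ℤ} (hj : 0 < j) (hp : p ∈ forms K n j) :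
    p ∈ irrelevant K n := by
  rw [mem_irrelevant_iff]
  intro u hu
  by_contra! h
  have hu0 : u = 0 := Finsupp.ext h
  have := mem_forms_iff.1 hp u (mem_support_iff.1 hu)
  rw [hu0] at this
  simp at this
  omega

theorem irrelevant_ne_top : irrelevant K n ≠ ⊤ := by
  intro h
  have h1 : (1 : S K n) ∈ irrelevant K n := h ▸ Submodule.mem_top
  rw [mem_irrelevant_iff] at h1
  obtain ⟨i, hi⟩ := h1 0 (by simp)
  simp at hi

theorem mul_mem_of_mem_irrelevant {Q : Ideal (S K n)} {p : S K n} (hp : ∀ i, X i * p ∈ Q)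
    {a : S K n} (ha : a ∈ irrelevant K n) : a * p ∈ Q := by
  have h : irrelevant K n ≤ Q.colon {p} := by
    rw [irrelevant, Ideal.span_le]
    rintro _ ⟨i, rfl⟩
    rw [SetLike.mem_coe, Submodule.mem_colon_singleton]
    exact hp i
  exact Submodule.mem_colon_singleton.1 (h ha)

theorem exists_sub_C_mem_irrelevant (p : S K n) : p - C (coeff 0 p) ∈ irrelevant K n := by
  rw [mem_irrelevant_iff]
  intro u hu
  by_contra! h
  have hu0 : u = 0 := Finsupp.ext h
  rw [mem_support_iff, hu0] at hu
  simp at hu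

/-- The map `S/m → S/Q` with value the class of `p` at `1`, for `p` with `m p ⊆ Q`. -/
def socleHom {Q : Ideal (S K n)} {p : S K n} (hp : ∀ i, X i * p ∈ Q) :
    (S K n ⧸ irrelevant K n) →ₗ[S K n] (S K n ⧸ Q) :=
  Submodule.liftQ _ (LinearMap.toSpanSingleton (S K n) (S K n ⧸ Q) (Ideal.Quotient.mk Q p))
    fun a ha => by
      rw [LinearMap.mem_ker, LinearMap.toSpanSingleton_apply]
      exact Ideal.Quotient.eq_zero_iff_mem.2 (mul_mem_of_mem_irrelevant hp ha)

theorem socleHom_one {Q : Ideal (S K n)} {p : S K n} (hp : ∀ i, X i * p ∈ Q) :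
    socleHom hp (Ideal.Quotient.mk _ 1) = Ideal.Quotient.mk Q p := by
  change Submodule.liftQ _ _ _ (Submodule.Quotient.mk 1) = _
  rw [Submodule.liftQ_apply, LinearMap.toSpanSingleton_apply, one_smul]

/-- `Q` is saturated in the weak form that `m` is not associated to `S/Q`. -/
def IsSat (Q : Ideal (S K n)) : Prop := ∀ p, (∀ i, X i * p ∈ Q) → p ∈ Q

/-- The residue ring of a regular sequence of length `n` in `n + 1` variables has positive
depth. -/
theorem IsRegSeq.isSat {g : Fin n → S K n} (hg : IsRegSeq g) (hgm : ∀ i, g i ∈ irrelevant K n) :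
    IsSat (Ideal.span (Set.range g)) := by
  intro p hp
  have hX := isRegSeq_X K n
  obtain ⟨e⟩ := nonempty_hom_quotient_equiv irrelevant_ne_top hg hX.castSucc hgm
    fun i => Ideal.subset_span ⟨i.castSucc, rfl⟩
  -- The last variable kills `S/m` but is a nonzerodivisor modulo the other variables, so no nonzero
  -- map exists.
  have h0 : ∀ φ : (S K n ⧸ irrelevant K n) →ₗ[S K n] (S K n ⧸ Ideal.span (Set.range
      fun i : Fin n => (X i.castSucc : S K n))), φ = 0 := by
    intro φ
    obtain ⟨q, hq⟩ := Ideal.Quotient.mk_surjective (φ (Ideal.Quotient.mk _ 1))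
    have h1 : Ideal.Quotient.mk (Ideal.span (Set.range
      fun i : Fin n => (X i.castSucc : S K n))) (X (Fin.last n) * q) = 0 := by
      have h2 : (X (Fin.last n) : S K n) • Ideal.Quotient.mk (irrelevant K n) 1 = 0 := by
        refine Ideal.Quotient.eq_zero_iff_mem.2 ?_
        change X (Fin.last n) * 1 ∈ irrelevant K n
        rw [mul_one]
        exact Ideal.subset_span ⟨_, rfl⟩
      have h3 := φ.map_smul (X (Fin.last n)) (Ideal.Quotient.mk (irrelevant K n) 1)
      rw [h2, map_zero, ← hq] at h3
      exact h3.symm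
    have h4 := hX.last q (Ideal.Quotient.eq_zero_iff_mem.1 h1)
    rw [Ideal.Quotient.eq_zero_iff_mem.2 h4] at hq
    refine LinearMap.ext fun b => ?_
    obtain ⟨b, rfl⟩ := Ideal.Quotient.mk_surjective b
    have h5 : Ideal.Quotient.mk (irrelevant K n) b = b • Ideal.Quotient.mk (irrelevant K n) 1 := by
      change _ = Ideal.Quotient.mk (irrelevant K n) (b * 1)
      rw [mul_one]
    rw [h5, map_smul, ← hq, smul_zero, LinearMap.zero_apply]
  have h1 : socleHom hp = 0 := e.injective (by rw [h0 (e _), map_zero])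
  have h2 := socleHom_one hp
  rw [h1, LinearMap.zero_apply] at h2
  exact Ideal.Quotient.eq_zero_iff_mem.1 h2.symm

/-- The socle of the residue ring of a regular sequence of length `n + 1` in `n + 1` variables
has dimension at most one. -/
theorem IsRegSeq.exists_socle {g : Fin (n + 1) → S K n} (hg : IsRegSeq g)
    (hgm : ∀ i, g i ∈ irrelevant K n) {p q : S K n}
    (hp : ∀ i, X i * p ∈ Ideal.span (Set.range g)) (hq : ∀ i, X i * q ∈ Ideal.span (Set.range g))
    (hq0 : q ∉ Ideal.span (Set.range g)) :
    ∃ s : S K n, p - s * q ∈ Ideal.span (Set.range g) := by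
  obtain ⟨e⟩ := nonempty_hom_quotient_equiv irrelevant_ne_top hg (isRegSeq_X K n) hgm
    fun i => Ideal.subset_span ⟨i, rfl⟩
  have hmk (b : S K n) : Ideal.Quotient.mk (irrelevant K n) b =
      b • Ideal.Quotient.mk (irrelevant K n) 1 := by
    change _ = Ideal.Quotient.mk (irrelevant K n) (b * 1)
    rw [mul_one]
  have hmax (φ ψ : (S K n ⧸ irrelevant K n) →ₗ[S K n] (S K n ⧸ irrelevant K n))
      (hψ : ψ ≠ 0) : ∃ s : S K n, φ = s • ψ := by
    obtain ⟨a, ha⟩ := Ideal.Quotient.mk_surjective (φ (Ideal.Quotient.mk _ 1))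
    obtain ⟨b, hb⟩ := Ideal.Quotient.mk_surjective (ψ (Ideal.Quotient.mk _ 1))
    have hb' : Ideal.Quotient.mk (irrelevant K n) b =
        Ideal.Quotient.mk (irrelevant K n) (C (coeff 0 b)) :=
      (Ideal.Quotient.mk_eq_mk_iff_sub_mem _ _).2 (exists_sub_C_mem_irrelevant b)
    have hc : coeff 0 b ≠ 0 := by
      intro h0
      rw [h0, C_0, map_zero] at hb'
      refine hψ (LinearMap.ext fun x => ?_)
      obtain ⟨x, rfl⟩ := Ideal.Quotient.mk_surjective x
      rw [hmk, map_smul, ← hb, hb', smul_zero, LinearMap.zero_apply]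
    refine ⟨a * C (coeff 0 b)⁻¹, LinearMap.ext fun x => ?_⟩
    obtain ⟨x, rfl⟩ := Ideal.Quotient.mk_surjective x
    rw [hmk, LinearMap.smul_apply, map_smul, map_smul, ← ha, ← hb, hb', smul_comm]
    congr 1
    change _ = Ideal.Quotient.mk (irrelevant K n) ((a * C (coeff 0 b)⁻¹) * C (coeff 0 b))
    rw [mul_assoc, ← C_mul, inv_mul_cancel₀ hc, C_1, mul_one]
  -- The ideal of all variables is `m` by definition, so the comparison target is `Hom(S/m, S/m)`,
  -- where any nonzero map generates.
  have hmax' : ∀ φ ψ : (S K n ⧸ irrelevant K n) →ₗ[S K n]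
      (S K n ⧸ Ideal.span (Set.range (X : Fin (n + 1) → S K n))), ψ ≠ 0 → ∃ s : S K n, φ = s • ψ :=
    hmax
  obtain ⟨s, hs⟩ := hmax' (e (socleHom hp)) (e (socleHom hq)) (by
    intro h
    have h1 : socleHom hq = 0 := e.injective (by rw [map_zero]; exact h)
    have h2 := socleHom_one hq
    rw [h1, LinearMap.zero_apply] at h2
    exact hq0 (Ideal.Quotient.eq_zero_iff_mem.1 h2.symm))
  refine ⟨s, ?_⟩
  rw [← map_smul] at hs
  have h1 := e.injective hs
  have h2 := LinearMap.congr_fun h1 (Ideal.Quotient.mk _ 1)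
  rw [LinearMap.smul_apply, socleHom_one, socleHom_one] at h2
  exact (Ideal.Quotient.mk_eq_mk_iff_sub_mem _ _).1 h2

/-! ### Koszul relations and essential relations -/

theorem koszulRel_mem_KR (f : Fin (n + 1) → S K n) {i j : Fin (n + 1)} (h : i < j) :
    koszulRel f i j ∈ KR f := Submodule.subset_span ⟨i, j, h, rfl⟩

theorem exists_mem_KR_of_mem_idealW (f : Fin (n + 1) → S K n) {b : S K n} (hb : b ∈ idealW f) :
    ∃ r ∈ KR f, r 0 = b := by
  induction hb using Submodule.span_induction with
  | mem x hx =>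
    obtain ⟨i, rfl⟩ := hx
    refine ⟨_, koszulRel_mem_KR f (Fin.succ_pos i), ?_⟩
    simp [koszulRel, (Fin.succ_ne_zero i).symm]
  | zero => exact ⟨0, Submodule.zero_mem _, rfl⟩
  | add x y _ _ hx hy =>
    obtain ⟨r, hr, rfl⟩ := hx
    obtain ⟨t, ht, rfl⟩ := hy
    exact ⟨r + t, Submodule.add_mem _ hr ht, rfl⟩
  | smul c x _ hx =>
    obtain ⟨r, hr, rfl⟩ := hx
    exact ⟨c • r, Submodule.smul_mem _ c hr, rfl⟩

theorem apply_zero_mem_idealW (f : Fin (n + 1) → S K n) {r : Fin (n + 1) → S K n}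
    (hr : r ∈ KR f) : r 0 ∈ idealW f := by
  have h : KR f ≤ Submodule.comap (LinearMap.proj (R := S K n)
      (φ := fun _ : Fin (n + 1) => S K n) 0) (idealW f) := by
    rw [KR, Submodule.span_le]
    rintro _ ⟨i, j, hij, rfl⟩
    obtain ⟨j, rfl⟩ := Fin.exists_succ_eq.2 (Fin.ne_zero_of_lt hij)
    have h0 : Pi.single (M := fun _ => S K n) j.succ (f i) 0 = 0 :=
      Pi.single_eq_of_ne (Fin.succ_ne_zero j).symm _
    change koszulRel f i j.succ 0 ∈ idealW f
    rw [koszulRel, Pi.sub_apply, h0, sub_zero, Pi.single_apply]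
    split_ifs
    · exact Ideal.subset_span ⟨j, rfl⟩
    · exact Ideal.zero_mem _
  exact h hr

/-- Koszul relations between `f_k` and earlier members can clear the `k`-th coordinate without
disturbing the zeroth or the later ones. -/
theorem exists_mem_KR_of_mem_span (f : Fin (n + 1) → S K n) (k : Fin n) {b : S K n}
    (hb : b ∈ Ideal.span ((fun i : Fin n => f i.succ) '' Set.Iio k)) :
    ∃ r ∈ KR f, r k.succ = b ∧ r 0 = 0 ∧ ∀ i : Fin n, k < i → r i.succ = 0 := by
  induction hb using Submodule.span_induction with
  | mem x hx =>
    obtain ⟨i, hi, rfl⟩ := hx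
    have hi' : i < k := hi
    refine ⟨-koszulRel f i.succ k.succ,
      Submodule.neg_mem _ (koszulRel_mem_KR f (Fin.succ_lt_succ_iff.2 hi)), ?_, ?_, ?_⟩
    · simp [koszulRel, hi'.ne']
    · simp [koszulRel, (Fin.succ_ne_zero _).symm]
    · intro l hl
      simp [koszulRel, hl.ne', (hi'.trans hl).ne']
  | zero => exact ⟨0, Submodule.zero_mem _, rfl, rfl, fun _ _ => rfl⟩
  | add x y _ _ hx hy =>
    obtain ⟨r, hr, rfl, hr0, hr1⟩ := hx
    obtain ⟨t, ht, rfl, ht0, ht1⟩ := hy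
    exact ⟨r + t, Submodule.add_mem _ hr ht, rfl, by simp [hr0, ht0],
      fun i hi => by simp [hr1 i hi, ht1 i hi]⟩
  | smul c x _ hx =>
    obtain ⟨r, hr, rfl, hr0, hr1⟩ := hx
    exact ⟨c • r, Submodule.smul_mem _ c hr, rfl, by simp [hr0], fun i hi => by simp [hr1 i hi]⟩

/-- The relations of a regular sequence are spanned by the Koszul relations. -/
theorem mem_KR_of_apply_zero {f : Fin (n + 1) → S K n} (hreg : IsRegSeq fun i : Fin n => f i.succ)
    {a : Fin (n + 1) → S K n} (ha : a ∈ AR f) (h0 : a 0 = 0) : a ∈ KR f := by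
  -- Elimination from the top: regularity puts the last possibly nonzero coordinate in the ideal of
  -- the earlier `f_i`, so a Koszul relation removes it.
  have key : ∀ k ≤ n, ∀ a ∈ AR f, a 0 = 0 → (∀ i : Fin n, k ≤ i → a i.succ = 0) → a ∈ KR f := by
    intro k
    induction k with
    | zero =>
      intro _ a _ h0 h
      have : a = 0 := by
        funext i
        induction i using Fin.cases with
        | zero => exact h0
        | succ i => exact h i (Nat.zero_le _)
      rw [this]
      exact Submodule.zero_mem _
    | succ k ih =>
      intro hk a ha h0 h
      let κ : Fin n := ⟨k, hk⟩
      have hmem : a κ.succ ∈ Ideal.span ((fun i : Fin n => f i.succ) '' Set.Iio κ) := by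
        refine hreg κ _ ?_
        have hsum := mem_AR.1 ha
        rw [Fin.sum_univ_succ, h0, zero_mul, zero_add, Finset.univ.sum_eq_add_sum_sdiff_singleton_of_mem
          (Finset.mem_univ κ)] at hsum
        rw [mul_comm, eq_neg_of_add_eq_zero_left hsum]
        refine Submodule.neg_mem _ (Ideal.sum_mem _ fun i hi => ?_)
        rcases lt_trichotomy i κ with hlt | heq | hgt
        · exact Ideal.mul_mem_left _ _ (Ideal.subset_span ⟨i, hlt, rfl⟩)
        · simp [heq] at hi
        · rw [h i (by rw [Fin.lt_def] at hgt; exact hgt), zero_mul]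
          exact Ideal.zero_mem _
      obtain ⟨r, hr, hr1, hr2, hr3⟩ := exists_mem_KR_of_mem_span f κ hmem
      rw [← sub_add_cancel a r]
      refine Submodule.add_mem _ (ih (by omega) _ (Submodule.sub_mem _ ha (KR_le_AR f hr)) ?_ ?_) hr
      · rw [Pi.sub_apply, h0, hr2, sub_zero]
      · intro i hi
        rw [Pi.sub_apply]
        rcases hi.lt_or_eq with hlt | heq
        · rw [h i hlt, hr3 i hlt, sub_zero]
        · have : i = κ := Fin.ext heq.symm
          rw [this, hr1, sub_self]
  exact key n le_rfl a ha h0 fun i hi => absurd i.2 (by omega)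

theorem mem_KR_iff {f : Fin (n + 1) → S K n} (hreg : IsRegSeq fun i : Fin n => f i.succ)
    {a : Fin (n + 1) → S K n} (ha : a ∈ AR f) : a ∈ KR f ↔ a 0 ∈ idealW f := by
  refine ⟨apply_zero_mem_idealW f, fun h => ?_⟩
  obtain ⟨r, hr, hr0⟩ := exists_mem_KR_of_mem_idealW f h
  rw [← sub_add_cancel a r]
  refine Submodule.add_mem _ (mem_KR_of_apply_zero hreg
    (Submodule.sub_mem _ ha (KR_le_AR f hr)) ?_) hr
  rw [Pi.sub_apply, hr0, sub_self]

theorem mul_apply_zero_mem_idealW {f a : Fin (n + 1) → S K n} (ha : a ∈ AR f) :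
    f 0 * a 0 ∈ idealW f := by
  have h := mem_AR.1 ha
  rw [Fin.sum_univ_succ] at h
  rw [mul_comm, eq_neg_of_add_eq_zero_left h]
  exact Submodule.neg_mem _ (Ideal.sum_mem _ fun i _ =>
    Ideal.mul_mem_left _ _ (Ideal.subset_span ⟨i, rfl⟩))

theorem exists_AR_of_mul_mem {f : Fin (n + 1) → S K n} {h : S K n} (hh : f 0 * h ∈ idealW f) :
    ∃ a : AR f, a.1 0 = h := by
  obtain ⟨c, hc⟩ := (Ideal.mem_span_range_iff_exists_fun).1 hh
  refine ⟨⟨Fin.cons h fun i => -c i, mem_AR.2 ?_⟩, rfl⟩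
  rw [Fin.sum_univ_succ]
  simp only [Fin.cons_zero, Fin.cons_succ, neg_mul, Finset.sum_neg_distrib, hc]
  ring

/-- Since the `f_i` are forms, the component of total degree `j + d 0` of any relation is again a
relation. -/
theorem exists_ARpiece_of_mul_mem {d : Fin (n + 1) → ℕ} {f : Fin (n + 1) → S K n}
    (hf : ∀ i, f i ∈ forms K n (d i)) {j : ℤ} {h : S K n} (hj : h ∈ forms K n j)
    (hh : f 0 * h ∈ idealW f) : ∃ a ∈ ARpiece d f (j + d 0), a.1 0 = h := by
  obtain ⟨a, ha⟩ := exists_AR_of_mul_mem hh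
  refine ⟨⟨fun i => comp (j + d 0 - d i) (a.1 i), mem_AR.2 ?_⟩, fun i => comp_mem _ _, ?_⟩
  · have h2 := congrArg (comp (j + d 0)) (mem_AR.1 a.2)
    rw [map_sum, map_zero] at h2
    rw [← h2]
    exact Finset.sum_congr rfl fun i _ => (comp_mul (hf i) _ _).symm
  · change comp (j + d 0 - d 0) (a.1 0) = h
    rw [ha, add_sub_cancel_right, comp_of_mem hj]

theorem mk_mem_ker_mulQuot_iff {Q : Ideal (S K n)} {g h : S K n} :
    Ideal.Quotient.mk Q h ∈ LinearMap.ker (mulQuot Q g) ↔ g * h ∈ Q := by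
  rw [LinearMap.mem_ker, ← Ideal.Quotient.eq_zero_iff_mem]
  rfl

/-- The map `AR(f) → ker (f_0 : S/W → S/W)` with `(a_0, …, a_n) ↦ [a_0]`. -/
def firstCoord (f : Fin (n + 1) → S K n) :
    AR f →ₗ[S K n] LinearMap.ker (mulQuot (idealW f) (f 0)) where
  toFun a := ⟨Ideal.Quotient.mk (idealW f) (a.1 0),
    mk_mem_ker_mulQuot_iff.2 (mul_apply_zero_mem_idealW a.2)⟩
  map_add' _ _ := rfl
  map_smul' _ _ := rfl

theorem coe_firstCoord {f : Fin (n + 1) → S K n} (a : AR f) :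
    (firstCoord f a : S K n ⧸ idealW f) = Ideal.Quotient.mk (idealW f) (a.1 0) := rfl

theorem ker_firstCoord {f : Fin (n + 1) → S K n} (hreg : IsRegSeq fun i : Fin n => f i.succ) :
    (KR f).submoduleOf (AR f) = LinearMap.ker (firstCoord f) := by
  ext a
  rw [LinearMap.mem_ker, ← Submodule.coe_eq_zero, coe_firstCoord, Ideal.Quotient.eq_zero_iff_mem,
    ← mem_KR_iff hreg a.2]
  rfl

theorem firstCoord_surjective (f : Fin (n + 1) → S K n) : Function.Surjective (firstCoord f) := by
  rintro ⟨b, hb⟩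
  obtain ⟨h, rfl⟩ := Ideal.Quotient.mk_surjective b
  obtain ⟨a, rfl⟩ := exists_AR_of_mul_mem (mk_mem_ker_mulQuot_iff.1 hb)
  exact ⟨a, rfl⟩

/-- The isomorphism `ER(f) ≃ ker (f_0 : S/W → S/W)`. -/
def essentialEquiv {f : Fin (n + 1) → S K n} (hreg : IsRegSeq fun i : Fin n => f i.succ) :
    ER f ≃ₗ[S K n] LinearMap.ker (mulQuot (idealW f) (f 0)) :=
  (Submodule.quotEquivOfEq _ _ (ker_firstCoord hreg)).trans
    ((firstCoord f).quotKerEquivOfSurjective (firstCoord_surjective f))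

theorem coe_essentialEquiv_mk {f : Fin (n + 1) → S K n}
    (hreg : IsRegSeq fun i : Fin n => f i.succ) (a : AR f) :
    (essentialEquiv hreg (Submodule.Quotient.mk a) : S K n ⧸ idealW f) =
      Ideal.Quotient.mk (idealW f) (a.1 0) := rfl

theorem essentialEquiv_image_ERpiece {d : Fin (n + 1) → ℕ} {f : Fin (n + 1) → S K n}
    (hf : ∀ i, f i ∈ forms K n (d i)) (hreg : IsRegSeq fun i : Fin n => f i.succ) (j : ℤ) :
    essentialEquiv hreg '' ERpiece d f (j + d 0) = kerPiece f j := by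
  ext ⟨b, hb⟩
  constructor
  · rintro ⟨_, ⟨a, ha, rfl⟩, h⟩
    have h2 := congrArg Subtype.val h
    have h3 := ha 0
    rw [add_sub_cancel_right] at h3
    change b ∈ quotPiece (idealW f) j
    rw [← show _ = b from h2]
    exact mk_mem_quotPiece h3
  · intro h
    obtain ⟨g, hg, rfl⟩ := exists_of_mem_quotPiece (show b ∈ quotPiece (idealW f) j from h)
    obtain ⟨a, ha, rfl⟩ := exists_ARpiece_of_mul_mem hf hg (mk_mem_ker_mulQuot_iff.1 hb)
    exact ⟨_, ⟨a, ha, rfl⟩, Subtype.ext (coe_essentialEquiv_mk hreg a)⟩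

/-! ### Injectivity on graded pieces and Hilbert series -/

theorem mulForm_injective_iff {Q : Ideal (S K n)} {g : S K n} {k : ℕ} (hg : g.IsHomogeneous k)
    (j : ℤ) : Function.Injective (mulForm Q hg j) ↔ ∀ h ∈ forms K n j, g * h ∈ Q → h ∈ Q := by
  have hμ (h : S K n) (hh : h ∈ forms K n j) :
      ((mulForm Q hg j ⟨_, mk_mem_quotPiece hh⟩ : quotPiece Q (j + k)) : S K n ⧸ Q) =
        Ideal.Quotient.mk Q (g * h) := by
    simp [mulForm]
  rw [← LinearMap.ker_eq_bot, LinearMap.ker_eq_bot']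
  constructor
  · intro H h hh hgh
    have h1 := H ⟨_, mk_mem_quotPiece hh⟩
      (Subtype.ext ((hμ h hh).trans (Ideal.Quotient.eq_zero_iff_mem.2 hgh)))
    exact Ideal.Quotient.eq_zero_iff_mem.1 (congrArg Subtype.val h1)
  · rintro H ⟨_, h, hh, rfl⟩ h0
    have h2 := (hμ h hh).symm.trans (congrArg Subtype.val h0)
    exact Subtype.ext (Ideal.Quotient.eq_zero_iff_mem.2
      (H h hh (Ideal.Quotient.eq_zero_iff_mem.1 h2)))

theorem coeff_hilbertSeries (Q : Ideal (S K n)) (p : ℕ) :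
    PowerSeries.coeff p (hilbertSeries Q) = hilb Q p := PowerSeries.coeff_mk _ _

theorem hilbertSeries_sup_span {Q : Ideal (S K n)} (hQ : Homog Q) {l : S K n} {e : ℕ}
    (hl : l ∈ forms K n e) (hnz : NZD Q l) :
    hilbertSeries (Q ⊔ Ideal.span {l}) = (1 - PowerSeries.X ^ e) * hilbertSeries Q := by
  ext p
  rw [sub_mul, one_mul, map_sub, PowerSeries.coeff_X_pow_mul', coeff_hilbertSeries,
    coeff_hilbertSeries]
  have h := hilb_sup_span hQ hl hnz (p - e)
  rw [sub_add_cancel] at h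
  split_ifs with hep
  · rw [coeff_hilbertSeries, Nat.cast_sub hep, ← h]
    push_cast
    ring
  · rw [hilb_of_neg Q (by omega : (p : ℤ) - e < 0), add_zero] at h
    rw [h, sub_zero]

theorem homog_span_range {r : ℕ} {g : Fin r → S K n} {d : Fin r → ℕ}
    (hd : ∀ i, g i ∈ forms K n (d i)) : Homog (Ideal.span (Set.range g)) :=
  homog_span (by rintro _ ⟨i, rfl⟩; exact ⟨_, hd i⟩)

theorem IsRegSeq.hilbertSeries_eq {r : ℕ} {g : Fin r → S K n} (hg : IsRegSeq g) {d : Fin r → ℕ}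
    (hd : ∀ i, g i ∈ forms K n (d i)) :
    hilbertSeries (Ideal.span (Set.range g)) =
      (∏ i, (1 - PowerSeries.X ^ d i)) * hilbertSeries (⊥ : Ideal (S K n)) := by
  induction r with
  | zero => simp
  | succ r ih =>
    rw [span_range_succ_last, hilbertSeries_sup_span (homog_span_range fun i => hd i.castSucc)
      (hd _) hg.last, ih hg.castSucc fun i => hd i.castSucc, Fin.prod_univ_castSucc]
    ring

theorem hilbertSeries_irrelevant : hilbertSeries (irrelevant K n) = 1 := by
  ext p
  rw [coeff_hilbertSeries, PowerSeries.coeff_one]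
  split_ifs with hp
  · subst hp
    have h1 : hilb (irrelevant K n) 0 = 1 := by
      refine finrank_eq_one (⟨Ideal.Quotient.mk _ 1, mk_mem_quotPiece one_mem_forms⟩) ?_ ?_
      · intro h
        have h2 := Ideal.Quotient.eq_zero_iff_mem.1 (congrArg Subtype.val h)
        exact irrelevant_ne_top ((Ideal.eq_top_iff_one _).2 h2)
      · rintro ⟨_, g, hg, rfl⟩
        refine ⟨coeff 0 g, Subtype.ext ?_⟩
        change coeff 0 g • Ideal.Quotient.mk (irrelevant K n) 1 = Ideal.Quotient.mk _ g
        rw [eq_comm, (Ideal.Quotient.mk_eq_mk_iff_sub_mem _ _).2 (exists_sub_C_mem_irrelevant g),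
          ← mul_one (C (coeff 0 g)), ← smul_eq_C_mul]
        rfl
    exact_mod_cast h1
  · rw [hilb_eq_zero_iff.2 fun g hg => mem_irrelevant_of_mem_forms (by omega) hg, Nat.cast_zero]

/-- The residue ring of a regular sequence of forms of positive degrees `d_0, …, d_n` has Hilbert
series `∏ (1 + t + … + t ^ (d_i - 1))`. -/
theorem IsRegSeq.hilbertSeries_eq_prod {g : Fin (n + 1) → S K n} (hg : IsRegSeq g)
    {d : Fin (n + 1) → ℕ} (hd : ∀ i, g i ∈ forms K n (d i)) :
    hilbertSeries (Ideal.span (Set.range g)) =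
      ((∏ i, ∑ k ∈ Finset.range (d i), Polynomial.X ^ k : Polynomial ℤ) : PowerSeries ℤ) := by
  -- For the variables the formula reads `1 = (1 - t)^(n+1) * H_S`; this eliminates the Hilbert
  -- series of `S` without computing it.
  have hX := (isRegSeq_X K n).hilbertSeries_eq (d := fun _ => 1) X_mem_forms
  rw [← irrelevant, hilbertSeries_irrelevant] at hX
  have hgeom (m : ℕ) : (1 - PowerSeries.X ^ m : PowerSeries ℤ) =
      ((∑ k ∈ Finset.range m, Polynomial.X ^ k : Polynomial ℤ) : PowerSeries ℤ) *
        (1 - PowerSeries.X ^ 1) := by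
    have h := geom_sum_mul_neg (Polynomial.X : Polynomial ℤ) m
    have h2 := congrArg (fun P : Polynomial ℤ => (P : PowerSeries ℤ)) h
    simpa using h2.symm
  rw [hg.hilbertSeries_eq hd, Finset.prod_congr rfl fun i _ => hgeom (d i),
    Finset.prod_mul_distrib, mul_assoc, ← hX, mul_one, ← Polynomial.coeToPowerSeries.ringHom_apply,
    map_prod]
  rfl

theorem natDegree_geom_sum {m : ℕ} :
    (∑ k ∈ Finset.range m, Polynomial.X ^ k : Polynomial ℤ).natDegree = m - 1 := by
  rcases m with _ | m
  · simp
  · have h : (∑ k ∈ Finset.range m, Polynomial.X ^ k : Polynomial ℤ).degree <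
        (Polynomial.X ^ m : Polynomial ℤ).degree := by
      rw [Polynomial.degree_X_pow]
      refine (Polynomial.degree_sum_le _ _).trans_lt ((Finset.sup_lt_iff
        (WithBot.bot_lt_coe m)).2 fun k hk => ?_)
      rw [Polynomial.degree_X_pow]
      exact WithBot.coe_lt_coe.2 (Finset.mem_range.1 hk)
    rw [Finset.sum_range_succ, Polynomial.natDegree_add_eq_right_of_degree_lt h,
      Polynomial.natDegree_X_pow, Nat.add_sub_cancel]

/-! ### Duality for zero-dimensional complete intersections -/

section CompleteIntersection

variable {g : Fin (n + 1) → S K n} {d : Fin (n + 1) → ℕ}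

/-- The Hilbert series is a product of monic polynomials of degrees `d i - 1`, hence monic of degree
`σ`. -/
theorem IsRegSeq.hilb_of_gt (hg : IsRegSeq g) (hd : ∀ i, g i ∈ forms K n (d i))
    (hpos : ∀ i, 0 < d i) {σ : ℤ} (hσ : σ = (∑ i, (d i : ℤ)) - (n + 1)) :
    (∀ p, σ < p → hilb (Ideal.span (Set.range g)) p = 0) ∧
      hilb (Ideal.span (Set.range g)) σ = 1 := by
  have hmon (i : Fin (n + 1)) :
      (∑ k ∈ Finset.range (d i), Polynomial.X ^ k : Polynomial ℤ).Monic :=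
    Polynomial.monic_geom_sum_X (hpos i).ne'
  have hmon' := Polynomial.monic_prod_of_monic Finset.univ _ fun i _ => hmon i
  have hdeg := Polynomial.natDegree_prod_of_monic Finset.univ _ fun i _ => hmon i
  have hcoeff (p : ℕ) : (hilb (Ideal.span (Set.range g)) p : ℤ) =
      (∏ i, ∑ k ∈ Finset.range (d i), Polynomial.X ^ k : Polynomial ℤ).coeff p := by
    rw [← coeff_hilbertSeries, hg.hilbertSeries_eq_prod hd, Polynomial.coeff_coe]
  set P := (∏ i, ∑ k ∈ Finset.range (d i), Polynomial.X ^ k : Polynomial ℤ)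
  have hσ' : σ = P.natDegree := by
    rw [hdeg, hσ]
    simp only [natDegree_geom_sum]
    rw [Nat.cast_sum, Finset.sum_congr rfl fun i _ => Nat.cast_pred (R := ℤ) (hpos i),
      Finset.sum_sub_distrib]
    simp
  constructor
  · intro p hp
    lift p to ℕ using by omega
    have h := hcoeff p
    rw [Polynomial.coeff_eq_zero_of_natDegree_lt (by omega)] at h
    exact_mod_cast h
  · have h := hcoeff P.natDegree
    rw [hmon'.coeff_natDegree, ← hσ'] at h
    exact_mod_cast h

/-- A form `q ∉ (g)` of degree `σ` generates the socle. In `p - s * q ∈ (g)` the component of degree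
`j < σ` is `p` alone, as `s` has no component of negative degree. -/
theorem IsRegSeq.mem_of_socle (hg : IsRegSeq g) (hd : ∀ i, g i ∈ forms K n (d i))
    (hpos : ∀ i, 0 < d i) {σ : ℤ} (hσ : σ = (∑ i, (d i : ℤ)) - (n + 1)) {j : ℤ} (hj : j < σ)
    {p : S K n} (hp : p ∈ forms K n j) (hpX : ∀ i, X i * p ∈ Ideal.span (Set.range g)) :
    p ∈ Ideal.span (Set.range g) := by
  obtain ⟨h0, h1⟩ := hg.hilb_of_gt hd hpos hσ
  have hq : ∃ q ∈ forms K n σ, q ∉ Ideal.span (Set.range g) := by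
    by_contra! h
    rw [hilb_eq_zero_iff.2 h] at h1
    exact zero_ne_one h1
  obtain ⟨q, hq, hq0⟩ := hq
  obtain ⟨s, hs⟩ := hg.exists_socle
    (fun i => mem_irrelevant_of_mem_forms (by exact_mod_cast hpos i) (hd i)) hpX
    (fun i => hilb_eq_zero_iff.1 (h0 (1 + σ) (by omega)) _ (mul_mem_forms (X_mem_forms i) hq)) hq0
  have h2 := (homog_span_range hd).comp_mem j hs
  rwa [map_sub, comp_of_mem hp, comp_mul hq, forms_of_neg (by omega) (comp_mem (j - σ) s),
    zero_mul, sub_zero] at h2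

/-- The multiplication pairing into the socle degree is nondegenerate. -/
theorem IsRegSeq.mem_of_forall_mul_mem (hg : IsRegSeq g) (hd : ∀ i, g i ∈ forms K n (d i))
    (hpos : ∀ i, 0 < d i) {σ : ℤ} (hσ : σ = (∑ i, (d i : ℤ)) - (n + 1)) {j : ℤ}
    {p : S K n} (hp : p ∈ forms K n j)
    (hpu : ∀ u ∈ forms K n (σ - j), p * u ∈ Ideal.span (Set.range g)) :
    p ∈ Ideal.span (Set.range g) := by
  have key : ∀ k : ℕ, ∀ j : ℤ, σ - j < k → ∀ p ∈ forms K n j,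
      (∀ u ∈ forms K n (σ - j), p * u ∈ Ideal.span (Set.range g)) →
        p ∈ Ideal.span (Set.range g) := by
    intro k
    induction k with
    | zero =>
      intro j hj p hp _
      exact hilb_eq_zero_iff.1 ((hg.hilb_of_gt hd hpos hσ).1 j (by push_cast at hj; omega)) p hp
    | succ k ih =>
      intro j hj p hp h
      rcases lt_trichotomy j σ with hlt | heq | hgt
      -- Each `X i * p` inherits the hypothesis one degree closer to `σ`, so by induction `p` is a
      -- socle element of degree below `σ`.
      · refine hg.mem_of_socle hd hpos hσ hlt hp fun i => ?_
        refine ih (1 + j) (by push_cast at hj; omega) _ (mul_mem_forms (X_mem_forms i) hp) ?_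
        intro u hu
        have hXu : X i * u ∈ forms K n (σ - j) := by
          have := mul_mem_forms (X_mem_forms i) hu
          rwa [show 1 + (σ - (1 + j)) = σ - j by ring] at this
        have h2 := h _ hXu
        rwa [show p * (X i * u) = X i * p * u by ring] at h2
      · subst heq
        simpa using h 1 (by rw [sub_self]; exact one_mem_forms)
      · exact hilb_eq_zero_iff.1 ((hg.hilb_of_gt hd hpos hσ).1 j hgt) p hp
  exact key ((σ - j).toNat + 1) j (by omega) p hp hpu

/-- The pairing of degrees `j` and `σ - j` into the socle is perfect, so a functional that vanishes
on `I` but not on some form outside `I` is multiplication by some `p`. -/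
theorem IsRegSeq.exists_annihilator (hg : IsRegSeq g) (hd : ∀ i, g i ∈ forms K n (d i))
    (hpos : ∀ i, 0 < d i) {σ : ℤ} (hσ : σ = (∑ i, (d i : ℤ)) - (n + 1))
    {I : Ideal (S K n)} (hI : Homog I) (hle : Ideal.span (Set.range g) ≤ I) {j : ℤ}
    (hj : ¬ ∀ u ∈ forms K n (σ - j), u ∈ I) :
    ∃ p ∈ forms K n j, p ∉ Ideal.span (Set.range g) ∧
      ∀ h ∈ I, p * h ∈ Ideal.span (Set.range g) := by
  set Q := Ideal.span (Set.range g)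
  have h1 : hilb Q σ = 1 := (hg.hilb_of_gt hd hpos hσ).2
  obtain ⟨⟨b, hb⟩, hb0, hbspan⟩ := finrank_eq_one_iff'.1 h1
  have hb0' : b ≠ 0 := fun h => hb0 (Subtype.ext h)
  obtain ⟨τ, hτ⟩ : ∃ τ : Module.Dual K (S K n ⧸ Q), τ b ≠ 0 := by
    by_contra! h
    exact hb0' ((Module.forall_dual_apply_eq_zero_iff K b).1 h)
  have hτ0 (x : S K n) (hx : x ∈ forms K n σ) (h : τ (Ideal.Quotient.mk Q x) = 0) : x ∈ Q := by
    obtain ⟨c, hc⟩ := hbspan ⟨_, mk_mem_quotPiece hx⟩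
    have hc' : c • b = Ideal.Quotient.mk Q x := congrArg Subtype.val hc
    rw [← hc', map_smul, smul_eq_mul] at h
    rw [← Ideal.Quotient.eq_zero_iff_mem, ← hc', (mul_eq_zero.1 h).resolve_right hτ, zero_smul]
  let B : quotPiece Q j →ₗ[K] quotPiece Q (σ - j) →ₗ[K] K :=
    ((LinearMap.mul K (S K n ⧸ Q)).compr₂ τ).domRestrict₁₂ _ _
  have hB (x y : S K n) (hx : x ∈ forms K n j) (hy : y ∈ forms K n (σ - j)) :
      B ⟨_, mk_mem_quotPiece hx⟩ ⟨_, mk_mem_quotPiece hy⟩ = τ (Ideal.Quotient.mk Q (x * y)) := by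
    rw [map_mul]
    rfl
  have hxy {x y : S K n} (hx : x ∈ forms K n j) (hy : y ∈ forms K n (σ - j)) :
      x * y ∈ forms K n σ := by
    have := mul_mem_forms hx hy
    rwa [add_sub_cancel] at this
  have hinj : Function.Injective B := by
    rw [← LinearMap.ker_eq_bot, LinearMap.ker_eq_bot']
    rintro ⟨_, x, hx, rfl⟩ h0
    refine Subtype.ext (Ideal.Quotient.eq_zero_iff_mem.2
      (hg.mem_of_forall_mul_mem hd hpos hσ hx fun u hu => hτ0 _ (hxy hx hu) ?_))
    rw [← hB x u hx hu]
    exact LinearMap.congr_fun h0 _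
  have hinj' : Function.Injective B.flip := by
    rw [← LinearMap.ker_eq_bot, LinearMap.ker_eq_bot']
    rintro ⟨_, y, hy, rfl⟩ h0
    refine Subtype.ext (Ideal.Quotient.eq_zero_iff_mem.2
      (hg.mem_of_forall_mul_mem hd hpos hσ hy fun u hu => ?_))
    rw [sub_sub_cancel] at hu
    rw [mul_comm]
    refine hτ0 _ (hxy hu hy) ?_
    rw [← hB u y hu hy]
    exact LinearMap.congr_fun h0 ⟨_, mk_mem_quotPiece hu⟩
  have hperf : B.IsPerfPair := LinearMap.IsPerfPair.of_injective hinj hinj'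
  push Not at hj
  obtain ⟨u, hu, huI⟩ := hj
  let V : Submodule K (quotPiece Q (σ - j)) := Submodule.comap (quotPiece Q (σ - j)).subtype
    ((I.map (Ideal.Quotient.mk Q)).restrictScalars K)
  have hmkI {x : S K n} : Ideal.Quotient.mk Q x ∈ I.map (Ideal.Quotient.mk Q) ↔ x ∈ I := by
    rw [Ideal.mem_quotient_iff_mem hle]
  obtain ⟨φ, hφu, hφV⟩ := Submodule.exists_le_ker_of_notMem
    (p := V) (v := ⟨_, mk_mem_quotPiece hu⟩) (fun h => huI (hmkI.1 h))
  obtain ⟨⟨_, p, hp, rfl⟩, hpφ⟩ := hperf.bijective_left.2 φ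
  refine ⟨p, hp, fun hpQ => hφu ?_, ?_⟩
  · rw [← hpφ]
    refine (hB p u hp hu).trans ?_
    rw [Ideal.Quotient.eq_zero_iff_mem.2 (Q.mul_mem_right u hpQ), map_zero]
  · intro h hh
    refine mem_of_comp_mem fun i => ?_
    rw [mul_comm, comp_mul hp]
    have hc := hI.comp_mem (i - j) hh
    have hcm := comp_mem (i - j) h
    have hcp : comp (i - j) h * p ∈ forms K n i := by
      have := mul_mem_forms hcm hp
      rwa [sub_add_cancel] at this
    -- The functional only sees degree `σ - j`; nondegeneracy extends `p * I ⊆ Q` to all degrees,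
    -- since `I` is stable under multiplication by `v`.
    refine hg.mem_of_forall_mul_mem hd hpos hσ hcp fun v hv => ?_
    have hcv : comp (i - j) h * v ∈ forms K n (σ - j) := by
      have := mul_mem_forms hcm hv
      rwa [show i - j + (σ - i) = σ - j by ring] at this
    rw [show comp (i - j) h * p * v = p * (comp (i - j) h * v) by ring]
    refine hτ0 _ (hxy hp hcv) ?_
    rw [← hB p _ hp hcv]
    refine (LinearMap.congr_fun hpφ _).trans (LinearMap.mem_ker.1 (hφV ?_))
    exact hmkI.2 (I.mul_mem_right v hc)

/-- Duality for a complete intersection of dimension zero: the annihilator of `I` in `S/Q` vanishes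
in degree `j` if and only if `S/I` vanishes in the complementary degree. -/
theorem IsRegSeq.annihilator_iff (hg : IsRegSeq g) (hd : ∀ i, g i ∈ forms K n (d i))
    (hpos : ∀ i, 0 < d i) {σ : ℤ} (hσ : σ = (∑ i, (d i : ℤ)) - (n + 1))
    {I : Ideal (S K n)} (hI : Homog I) (hle : Ideal.span (Set.range g) ≤ I) (j : ℤ) :
    (∀ p ∈ forms K n j, (∀ h ∈ I, p * h ∈ Ideal.span (Set.range g)) →
      p ∈ Ideal.span (Set.range g)) ↔ hilb I (σ - j) = 0 := by
  rw [hilb_eq_zero_iff]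
  constructor
  · intro h
    by_contra hj
    obtain ⟨p, hp, hpQ, hpI⟩ := hg.exists_annihilator hd hpos hσ hI hle hj
    exact hpQ (h p hp hpI)
  · intro h p hp hpI
    exact hg.mem_of_forall_mul_mem hd hpos hσ hp fun u hu => hpI u (h u hu)

end CompleteIntersection

/-! ### Homogeneous prime avoidance over an arbitrary field -/

theorem exists_form_mem_notMem {P P' : Ideal (S K n)} (hP' : Homog P') (h : ¬ P' ≤ P) :
    ∃ (c : ℕ) (y : S K n), y ∈ forms K n c ∧ y ∈ P' ∧ y ∉ P := by
  obtain ⟨x, hx', hx⟩ := SetLike.not_le_iff_exists.1 h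
  have hj : ∃ j, comp j x ∉ P := by
    by_contra! hc
    exact hx (mem_of_comp_mem hc)
  obtain ⟨j, hj⟩ := hj
  have hj0 : 0 ≤ j := by
    by_contra! hneg
    rw [forms_of_neg hneg (comp_mem j x)] at hj
    exact hj P.zero_mem
  lift j to ℕ using hj0
  exact ⟨j, comp j x, comp_mem _ _, hP'.comp_mem _ hx', hj⟩

theorem exists_form_forall_mem_notMem {P : Ideal (S K n)} (hP : P.IsPrime)
    (T : Finset (Ideal (S K n))) (hT : ∀ P' ∈ T, Homog P' ∧ ¬ P' ≤ P) :
    ∃ (c : ℕ) (y : S K n), y ∈ forms K n c ∧ (∀ P' ∈ T, y ∈ P') ∧ y ∉ P := by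
  classical
  induction T using Finset.induction_on with
  | empty =>
    exact ⟨0, 1, one_mem_forms, by simp, (Ideal.ne_top_iff_one P).1 hP.ne_top⟩
  | insert P₁ T _ ih =>
    obtain ⟨c, y, hy, hyT, hyP⟩ := ih fun P' h => hT P' (Finset.mem_insert_of_mem h)
    obtain ⟨h1, h2⟩ := hT P₁ (Finset.mem_insert_self _ _)
    obtain ⟨c₁, z, hz, hz1, hzP⟩ := exists_form_mem_notMem h1 h2
    refine ⟨c + c₁, y * z, ?_, ?_, fun h => (hP.mem_or_mem h).elim hyP hzP⟩
    · push_cast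
      exact mul_mem_forms hy hz
    · intro P' hP'
      rcases Finset.mem_insert.1 hP' with rfl | hP'
      · exact P'.mul_mem_left _ hz1
      · exact P'.mul_mem_right _ (hyT P' hP')

/-- Prime avoidance by forms of every large degree, for pairwise incomparable primes. -/
theorem exists_form_notMem_of_antichain (T : Finset (Ideal (S K n)))
    (hT : ∀ P ∈ T, P.IsPrime ∧ Homog P ∧ ∃ i, X i ∉ P)
    (hanti : ∀ P ∈ T, ∀ P' ∈ T, P' ≤ P → P' = P) :
    ∃ N₀ : ℕ, ∀ N ≥ N₀, ∃ l ∈ forms K n (N : ℤ), ∀ P ∈ T, l ∉ P := by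
  classical
  have h1 : ∀ P : T, ∃ (c : ℕ) (y : S K n), y ∈ forms K n c ∧ (∀ P' ∈ T.erase P, y ∈ P') ∧
      y ∉ P.1 := fun P =>
    exists_form_forall_mem_notMem (hT P P.2).1 _ fun P' hP' =>
      ⟨(hT P' (Finset.mem_of_mem_erase hP')).2.1, fun hle =>
        Finset.ne_of_mem_erase hP' (hanti P P.2 P' (Finset.mem_of_mem_erase hP') hle)⟩
  choose c y hy hyT hyP using h1
  choose i hi using fun P : T => (hT P P.2).2.2
  -- Modulo a given prime only its own summand survives; the power of a variable outside that prime
  -- pads the degree to `N`.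
  refine ⟨Finset.univ.sup c, fun N hN => ⟨∑ P : T, y P * X (i P) ^ (N - c P), ?_, ?_⟩⟩
  · refine Submodule.sum_mem _ fun P _ => ?_
    have hc : c P ≤ N := (Finset.le_sup (Finset.mem_univ P)).trans hN
    have h := mul_mem_forms (hy P) (mem_forms_natCast.2 ((isHomogeneous_X K (i P)).pow (N - c P)))
    rwa [one_mul, Nat.cast_sub hc, add_sub_cancel] at h
  · intro P hP hmem
    have hprime := (hT P hP).1
    rw [Finset.univ.sum_eq_add_sum_sdiff_singleton_of_mem (Finset.mem_univ ⟨P, hP⟩)] at hmem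
    have h2 := (P.add_mem_iff_left (P.sum_mem fun P' hP' => ?_)).1 hmem
    · exact (hprime.mem_or_mem h2).elim (hyP ⟨P, hP⟩)
        fun h => hi ⟨P, hP⟩ (hprime.mem_of_pow_mem _ h)
    · refine P.mul_mem_right _ (hyT P' P (Finset.mem_erase.2 ⟨fun h => ?_, hP⟩))
      simp only [Finset.mem_sdiff, Finset.mem_singleton] at hP'
      exact hP'.2 (Subtype.ext h.symm)

theorem exists_form_notMem (T : Finset (Ideal (S K n)))
    (hT : ∀ P ∈ T, P.IsPrime ∧ Homog P ∧ ∃ i, X i ∉ P) :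
    ∃ N₀ : ℕ, ∀ N ≥ N₀, ∃ l ∈ forms K n (N : ℤ), ∀ P ∈ T, l ∉ P := by
  classical
  obtain ⟨N₀, hN₀⟩ := exists_form_notMem_of_antichain (T.filter (Maximal (· ∈ T)))
    (fun P hP => hT P (Finset.mem_filter.1 hP).1)
    (fun P hP P' hP' h => h.antisymm
      ((Finset.mem_filter.1 hP').2.2 (Finset.mem_filter.1 hP).1 h))
  refine ⟨N₀, fun N hN => ?_⟩
  obtain ⟨l, hl, hlT⟩ := hN₀ N hN
  refine ⟨l, hl, fun P hP hlP => ?_⟩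
  obtain ⟨P', hle, hmax⟩ := T.exists_le_maximal hP
  exact hlT P' (Finset.mem_filter.2 ⟨hmax.1, hmax⟩) (hle hlP)

/-- Homogeneous cores of the associated primes suffice, because a form in a prime lies in its core.
A core containing all variables would make `m` kill a nonzero class of `S/Q`. -/
theorem IsSat.exists_primes {Q : Ideal (S K n)} (hQ : IsSat Q) :
    ∃ T : Finset (Ideal (S K n)), (∀ P ∈ T, P.IsPrime ∧ Homog P ∧ ∃ i, X i ∉ P) ∧
      ∀ (j : ℤ), ∀ l ∈ forms K n j, (∀ P ∈ T, l ∉ P) → NZD Q l := by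
  classical
  have hfin := associatedPrimes.finite (S K n) (S K n ⧸ Q)
  refine ⟨hfin.toFinset.image fun P => (P.homogeneousCore (forms K n)).toIdeal, ?_, ?_⟩
  · intro P' hP'
    obtain ⟨P, hP, rfl⟩ := Finset.mem_image.1 hP'
    have hass : IsAssociatedPrime P (S K n ⧸ Q) := (Set.Finite.mem_toFinset hfin).1 hP
    rw [isAssociatedPrime_iff] at hass
    obtain ⟨hprime, x, hx⟩ := hass
    refine ⟨hprime.homogeneousCore, HomogeneousIdeal.isHomogeneous _, ?_⟩
    by_contra! h
    obtain ⟨p, rfl⟩ := Ideal.Quotient.mk_surjective x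
    have hp : p ∈ Q := hQ p fun i => by
      have h1 := Ideal.toIdeal_homogeneousCore_le _ _ (h i)
      rw [hx, Submodule.mem_colon_singleton, Submodule.mem_bot] at h1
      exact Ideal.Quotient.eq_zero_iff_mem.1 h1
    refine hprime.ne_top ((Ideal.eq_top_iff_one _).2 ?_)
    rw [hx, Submodule.mem_colon_singleton, Submodule.mem_bot, one_smul]
    exact Ideal.Quotient.eq_zero_iff_mem.2 hp
  · intro j l hl h p hp
    by_contra hpQ
    have hl' : l ∈ ⋃ P ∈ associatedPrimes (S K n) (S K n ⧸ Q), (P : Set (S K n)) := by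
      rw [biUnion_associatedPrimes_eq_zero_divisors]
      exact ⟨Ideal.Quotient.mk Q p, fun h0 => hpQ (Ideal.Quotient.eq_zero_iff_mem.1 h0),
        Ideal.Quotient.eq_zero_iff_mem.2 hp⟩
    obtain ⟨P, hP, hlP⟩ := Set.mem_iUnion₂.1 hl'
    exact h _ (Finset.mem_image.2 ⟨P, (Set.Finite.mem_toFinset hfin).2 hP, rfl⟩)
      (Ideal.mem_homogeneousCore_of_homogeneous_of_mem ⟨j, hl⟩ hlP)

/-- In every large degree there is a form that is a nonzerodivisor modulo two given saturated
ideals. -/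
theorem IsSat.exists_form_NZD {Q I : Ideal (S K n)} (hQ : IsSat Q) (hI : IsSat I) :
    ∃ N₀ : ℕ, ∀ N ≥ N₀, ∃ l ∈ forms K n (N : ℤ), NZD Q l ∧ NZD I l := by
  classical
  obtain ⟨T, hT, hTl⟩ := hQ.exists_primes
  obtain ⟨U, hU, hUl⟩ := hI.exists_primes
  obtain ⟨N₀, h⟩ := exists_form_notMem (T ∪ U) fun P hP =>
    (Finset.mem_union.1 hP).elim (hT P) (hU P)
  refine ⟨N₀, fun N hN => ?_⟩
  obtain ⟨l, hl, hlP⟩ := h N hN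
  exact ⟨l, hl, hTl _ l hl fun P hP => hlP P (Finset.mem_union_left _ hP),
    hUl _ l hl fun P hP => hlP P (Finset.mem_union_right _ hP)⟩

/-- A constant member is either a unit or zero, and zero is a nonzerodivisor only modulo the unit
ideal. -/
theorem IsRegSeq.degree_pos {r : ℕ} {g : Fin r → S K n} {d : Fin r → ℕ} (hg : IsRegSeq g)
    (hd : ∀ i, g i ∈ forms K n (d i)) (htop : Ideal.span (Set.range g) ≠ ⊤) (i : Fin r) :
    0 < d i := by
  by_contra! h0
  have h1 : (g i).IsHomogeneous 0 := mem_forms_natCast.1 (Nat.le_zero.1 h0 ▸ hd i)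
  have h2 : g i = C (coeff 0 (g i)) := (totalDegree_eq_zero_iff_eq_C).1
    ((totalDegree_zero_iff_isHomogeneous _).2 h1)
  by_cases hc : coeff 0 (g i) = 0
  · rw [hc, C_0] at h2
    have h3 := hg i 1 (by rw [h2, zero_mul]; exact Ideal.zero_mem _)
    exact htop ((Ideal.eq_top_iff_one _).2 (Ideal.span_mono (Set.image_subset_range _ _) h3))
  · refine htop (Ideal.eq_top_of_isUnit_mem _ (Ideal.subset_span ⟨i, rfl⟩) ?_)
    rw [h2]
    exact (isUnit_iff_ne_zero.2 hc).map C

theorem comp_mem_of_mem_sup_span {Q : Ideal (S K n)} (hQ : Homog Q) {l : S K n} {e m : ℤ}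
    (hl : l ∈ forms K n e) (hm : m < e) {x : S K n} (hx : x ∈ Q ⊔ Ideal.span {l}) :
    comp m x ∈ Q := by
  obtain ⟨q, hq, r, hr, rfl⟩ := Submodule.mem_sup.1 hx
  obtain ⟨c, rfl⟩ := Ideal.mem_span_singleton'.1 hr
  rw [map_add, comp_mul hl, forms_of_neg (by omega) (comp_mem (m - e) c), zero_mul, add_zero]
  exact hQ.comp_mem m hq

theorem exists_comp_eq_zero (x : S K n) : ∃ D : ℤ, ∀ i, D < i → comp i x = 0 := by
  classical
  obtain ⟨D, hD⟩ := (DirectSum.decompose (forms K n) x).support.exists_le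
  refine ⟨D, fun i hi => ?_⟩
  by_contra h
  have := hD i (DFinsupp.mem_support_iff.2 fun h0 => h (by rw [comp_apply, h0]; rfl))
  omega

theorem exists_generators_comp_eq_zero (I : Ideal (S K n)) :
    ∃ (T : Finset (S K n)) (D : ℤ), Ideal.span (T : Set (S K n)) = I ∧
      ∀ t ∈ T, ∀ i, D < i → comp i t = 0 := by
  classical
  obtain ⟨T, hT⟩ := (isNoetherian_def.1 (inferInstance : IsNoetherianRing (S K n))) I
  choose D hD using fun x : S K n => exists_comp_eq_zero x
  obtain ⟨M, hM⟩ := (T.image D).exists_le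
  exact ⟨T, M, hT, fun t ht i hi => hD t i ((hM _ (Finset.mem_image_of_mem D ht)).trans_lt hi)⟩

/-! ### From dimension one to dimension zero -/

section Linkage

variable {g : Fin n → S K n} {d : Fin n → ℕ}

theorem span_range_snoc (g : Fin n → S K n) (l : S K n) :
    Ideal.span (Set.range (Fin.snoc g l : Fin (n + 1) → S K n)) =
      Ideal.span (Set.range g) ⊔ Ideal.span {l} := by
  rw [span_range_succ_last]
  simp

theorem snoc_mem_forms (hd : ∀ i, g i ∈ forms K n (d i)) {l : S K n} {e : ℕ}
    (hl : l ∈ forms K n e) (i : Fin (n + 1)) :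
    (Fin.snoc g l : Fin (n + 1) → S K n) i ∈
      forms K n ((Fin.snoc d e : Fin (n + 1) → ℕ) i : ℤ) := by
  induction i using Fin.lastCases with
  | last => simpa using hl
  | cast i => simpa using hd i

theorem snoc_pos (hpos : ∀ i, 0 < d i) {e : ℕ} (he : 0 < e) (i : Fin (n + 1)) :
    0 < (Fin.snoc d e : Fin (n + 1) → ℕ) i := by
  induction i using Fin.lastCases with
  | last => simpa using he
  | cast i => simpa using hpos i

theorem sum_snoc {s : ℤ} (hs : s = (∑ i, (d i : ℤ)) - n - 1) (e : ℕ) :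
    s + e = (∑ i, ((Fin.snoc d e : Fin (n + 1) → ℕ) i : ℤ)) - (n + 1) := by
  rw [Fin.sum_univ_castSucc]
  simp only [Fin.snoc_castSucc, Fin.snoc_last]
  rw [hs]
  ring

theorem IsRegSeq.hilb_sup_span_of_gt (hg : IsRegSeq g) (hd : ∀ i, g i ∈ forms K n (d i))
    (hpos : ∀ i, 0 < d i) {s : ℤ} (hs : s = (∑ i, (d i : ℤ)) - n - 1) {e : ℕ} (he : 0 < e)
    {l : S K n} (hl : l ∈ forms K n e) (hW : NZD (Ideal.span (Set.range g)) l) {p : ℤ}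
    (hp : s + e < p) : hilb (Ideal.span (Set.range g) ⊔ Ideal.span {l}) p = 0 := by
  rw [← span_range_snoc]
  exact ((hg.snoc hW).hilb_of_gt (snoc_mem_forms hd hl) (snoc_pos hpos he) (sum_snoc hs e)).1 p hp

/-- The Hilbert function of `S/I` is constant in large degrees. -/
theorem IsRegSeq.hilb_succ (hg : IsRegSeq g) (hd : ∀ i, g i ∈ forms K n (d i))
    (hpos : ∀ i, 0 < d i) {s : ℤ} (hs : s = (∑ i, (d i : ℤ)) - n - 1) {I : Ideal (S K n)}
    (hI : Homog I) (hsat : IsSat I) (hle : Ideal.span (Set.range g) ≤ I) {q : ℤ} (hq : s < q) :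
    hilb I (q + 1) = hilb I q := by
  have hWsat := hg.isSat fun i => mem_irrelevant_of_mem_forms (by exact_mod_cast hpos i) (hd i)
  obtain ⟨N₀, hN₀⟩ := hWsat.exists_form_NZD hsat
  have key (N : ℕ) (hN : N₀ ≤ N) (hN1 : 0 < N) (q : ℤ) (hq : s < q) :
      hilb I (q + N) = hilb I q := by
    obtain ⟨l, hl, hlW, hlI⟩ := hN₀ N hN
    have h1 := hilb_sup_span hI hl hlI q
    have h2 := hg.hilb_sup_span_of_gt hd hpos hs hN1 hl hlW (p := q + N) (by omega)
    rw [hilb_eq_zero_of_le (sup_le_sup_right hle _) h2, zero_add] at h1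
    exact h1.symm
  -- Two consecutive steps reach the same degree: `q + (N₀ + 2) = (q + 1) + (N₀ + 1)`.
  have h1 := key (N₀ + 2) (by omega) (by omega) q hq
  have h2 := key (N₀ + 1) (by omega) (by omega) (q + 1) (by omega)
  rw [← h2, ← h1]
  congr 1
  push_cast
  ring

/-- Duality for the ideals containing a complete intersection of dimension one: the piece of degree
`j` of the annihilator of `I` modulo `W` is governed by the Hilbert function of `S/I` at `s - j`. -/
theorem IsRegSeq.link_iff (hg : IsRegSeq g) (hd : ∀ i, g i ∈ forms K n (d i))
    (hpos : ∀ i, 0 < d i) {s : ℤ} (hs : s = (∑ i, (d i : ℤ)) - n - 1) {I : Ideal (S K n)}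
    (hI : Homog I) (hle : Ideal.span (Set.range g) ≤ I) (j : ℤ) :
    ∃ E : ℕ, ∀ e ≥ E, ∀ l ∈ forms K n (e : ℤ), NZD (Ideal.span (Set.range g)) l → NZD I l →
      ((∀ h ∈ forms K n j, (∀ t ∈ I, h * t ∈ Ideal.span (Set.range g)) →
        h ∈ Ideal.span (Set.range g)) ↔ hilb I (s + e - j) = hilb I (s - j)) := by
  obtain ⟨T, D, hT, hD⟩ := exists_generators_comp_eq_zero I
  have hWh : Homog (Ideal.span (Set.range g)) := homog_span_range hd
  -- With `e > j` and `e > j + D`, neither `h` nor its products with generators of `I` reach degree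
  -- `e`, and below that degree `W + (l)` agrees with `W`.
  refine ⟨(j + D).toNat + j.toNat + 1, fun e he l hl hlW hlI => ?_⟩
  have hle' : Ideal.span (Set.range (Fin.snoc g l : Fin (n + 1) → S K n)) ≤
      I ⊔ Ideal.span {l} := by
    rw [span_range_snoc]
    exact sup_le_sup_right hle _
  have hdual := (hg.snoc hlW).annihilator_iff (snoc_mem_forms hd hl) (snoc_pos hpos (by omega))
    (sum_snoc hs e) (hI.sup (homog_span_singleton hl)) hle' j
  have hH := hilb_sup_span hI hl hlI (s - j)
  have h0 : hilb (I ⊔ Ideal.span {l}) (s + e - j) = 0 ↔ hilb I (s + e - j) = hilb I (s - j) := by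
    rw [show s + (e : ℤ) - j = s - j + e by ring]
    omega
  rw [← h0, ← hdual, span_range_snoc]
  refine forall₂_congr fun h hh => ?_
  have hmem : h ∈ Ideal.span (Set.range g) ⊔ Ideal.span {l} ↔ h ∈ Ideal.span (Set.range g) := by
    refine ⟨fun hx => ?_, fun hx => Ideal.mem_sup_left hx⟩
    have := comp_mem_of_mem_sup_span hWh hl (m := j) (by omega) hx
    rwa [comp_of_mem hh] at this
  have hann : (∀ t ∈ I ⊔ Ideal.span {l}, h * t ∈ Ideal.span (Set.range g) ⊔ Ideal.span {l}) ↔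
      ∀ t ∈ I, h * t ∈ Ideal.span (Set.range g) := by
    constructor
    · intro H
      have hcol : I ≤ (Ideal.span (Set.range g)).colon {h} := by
        rw [← hT, Ideal.span_le]
        intro t ht
        rw [SetLike.mem_coe, Submodule.mem_colon_singleton, smul_eq_mul]
        refine mem_of_comp_mem fun m => ?_
        by_cases hm : D < m - j
        · rw [comp_mul hh, hD t ht _ hm, zero_mul]
          exact Ideal.zero_mem _
        · refine comp_mem_of_mem_sup_span hWh hl (by omega) ?_
          rw [mul_comm]
          exact H t (Ideal.mem_sup_left (hT ▸ Ideal.subset_span ht))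
      intro t ht
      rw [mul_comm]
      exact Submodule.mem_colon_singleton.1 (hcol ht)
    · intro H t ht
      obtain ⟨q, hq, r, hr, rfl⟩ := Submodule.mem_sup.1 ht
      rw [mul_add]
      exact Ideal.add_mem _ (Ideal.mem_sup_left (H q hq))
        (Ideal.mem_sup_right (Ideal.mul_mem_left _ _ hr))
  rw [hmem, hann]

end Linkage

/-! ### Saturation and dimension -/

section Saturation

theorem le_saturation (Q : Ideal (S K n)) : Q ≤ saturation Q :=
  fun _ hg => ⟨0, fun _ _ => Q.mul_mem_right _ hg⟩

theorem homog_irrelevant_pow (k : ℕ) : Homog (irrelevant K n ^ k) := by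
  induction k with
  | zero => rw [pow_zero, Ideal.one_eq_top]; exact Ideal.IsHomogeneous.top (forms K n)
  | succ k ih =>
    rw [pow_succ]
    exact ih.mul (homog_span_range (d := fun _ => 1) X_mem_forms)

theorem Homog.saturation {Q : Ideal (S K n)} (hQ : Homog Q) : Homog (saturation Q) := by
  refine Homog.of_comp_mem fun j p hp => ?_
  obtain ⟨k, hk⟩ := hp
  refine ⟨k, fun h hh => mem_of_comp_mem fun i => ?_⟩
  have h1 := (homog_irrelevant_pow k).comp_mem (i - j) hh
  have h2 := hQ.comp_mem i (hk _ h1)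
  rw [comp_mul (ACI.comp_mem (i - j) h), sub_sub_cancel] at h2
  rwa [mul_comm, comp_mul (ACI.comp_mem j p), mul_comm]

/-- One power of `m` works for all the `X i * p` at once; the next power works for `p`. -/
theorem isSat_saturation (Q : Ideal (S K n)) : IsSat (saturation Q) := by
  intro p hp
  choose k hk using hp
  have h1 (i : Fin (n + 1)) : X i * p ∈ Q.colon ((irrelevant K n ^ Finset.univ.sup k : Ideal _) :
      Set (S K n)) := by
    rw [Submodule.mem_colon]
    intro h hh
    exact hk i h (Ideal.pow_le_pow_right (Finset.le_sup (Finset.mem_univ i)) hh)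
  refine ⟨Finset.univ.sup k + 1, fun h hh => ?_⟩
  rw [pow_succ] at hh
  induction hh using Submodule.mul_induction_on' with
  | mem_mul_mem b hb a ha =>
    have h2 := Submodule.mem_colon.1 (mul_mem_of_mem_irrelevant h1 ha) b hb
    rw [smul_eq_mul] at h2
    rwa [show p * (b * a) = a * p * b by ring]
  | add x _ y _ hx hy =>
    rw [mul_add]
    exact Q.add_mem hx hy

theorem IsSat.hilb_zero {Q : Ideal (S K n)} (hQ : IsSat Q) {q : ℕ} (hq : hilb Q q = 0) :
    hilb Q 0 = 0 := by
  induction q with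
  | zero => exact hq
  | succ q ih =>
    refine ih (hilb_eq_zero_iff.2 fun p hp => hQ p fun i => hilb_eq_zero_iff.1 hq _ ?_)
    have := mul_mem_forms (X_mem_forms i) hp
    rwa [show (1 : ℤ) + q = ((q + 1 : ℕ) : ℤ) by push_cast; ring] at this

theorem irrelevant_isMaximal : (irrelevant K n).IsMaximal := by
  rw [Ideal.isMaximal_iff]
  refine ⟨fun h => irrelevant_ne_top ((Ideal.eq_top_iff_one _).2 h), fun J x hle hx hxJ => ?_⟩
  have h1 := exists_sub_C_mem_irrelevant x
  have h2 : C (coeff 0 x) ∈ J := by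
    have := J.sub_mem hxJ (hle h1)
    rwa [sub_sub_cancel] at this
  have hc : coeff 0 x ≠ 0 := by
    intro h0
    rw [h0, C_0, sub_zero] at h1
    exact hx h1
  have h3 := Ideal.eq_top_of_isUnit_mem J h2 ((isUnit_iff_ne_zero.2 hc).map C)
  exact h3 ▸ Submodule.mem_top

/-- If the saturation of `Q` is the unit ideal in some degree, then `S/Q` has dimension zero. -/
theorem ringKrullDim_le_zero_of_hilb {Q : Ideal (S K n)} {q : ℕ}
    (hq : hilb (saturation Q) q = 0) : ringKrullDim (S K n ⧸ Q) ≤ 0 := by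
  obtain ⟨k, hk⟩ := hilb_eq_zero_iff.1 ((isSat_saturation Q).hilb_zero hq) 1 one_mem_forms
  -- Saturation carries vanishing down to degree `0`, so `1` lies in the saturation; then every
  -- prime over `Q` contains `m`.
  have hle : irrelevant K n ^ k ≤ Q := fun h hh => by simpa using hk h hh
  have hdim : Ring.KrullDimLE 0 (S K n ⧸ Q) := by
    rw [Ring.krullDimLE_zero_iff]
    intro P hP
    have hP' : (P.comap (Ideal.Quotient.mk Q)).IsPrime := hP.comap _
    have h1 : Q ≤ P.comap (Ideal.Quotient.mk Q) := fun x hx => by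
      rw [Ideal.mem_comap, Ideal.Quotient.eq_zero_iff_mem.2 hx]
      exact P.zero_mem
    have h2 : irrelevant K n ≤ P.comap (Ideal.Quotient.mk Q) :=
      hP'.le_of_pow_le (hle.trans h1)
    have h3 := irrelevant_isMaximal.eq_of_le hP'.ne_top h2
    have h4 : (P.comap (Ideal.Quotient.mk Q)).IsMaximal := h3 ▸ irrelevant_isMaximal
    have h5 := Ideal.map_eq_top_or_isMaximal_of_surjective (Ideal.Quotient.mk Q) Ideal.Quotient.mk_surjective h4
    rw [Ideal.map_comap_of_surjective _ Ideal.Quotient.mk_surjective] at h5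
    exact h5.resolve_left hP.ne_top
  exact Ring.krullDimLE_iff.1 hdim

end Saturation

/-! ### The numerator of the Hilbert series -/

/-- A power series whose coefficients are eventually equal to a nonzero constant `c` is `F/(1-t)`
for a polynomial `F` with `F(1) ≠ 0`, and `deg F` is where the coefficients become constant. -/
theorem exists_polynomial_of_eventually_const (H : ℕ → ℤ) {M : ℕ}
    (hM : ∀ p, M ≤ p → H (p + 1) = H p) (hne : H M ≠ 0) :
    ∃ F : Polynomial ℤ, F.eval 1 ≠ 0 ∧
      PowerSeries.mk H * (1 - PowerSeries.X) = (F : PowerSeries ℤ) ∧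
      (∀ p, F.natDegree ≤ p → H p = H M) ∧ ∀ m, F.natDegree = m + 1 → H m ≠ H M := by
  have h0 : PowerSeries.coeff 0 (PowerSeries.mk H * (1 - PowerSeries.X)) = H 0 := by
    simp [mul_sub]
  have hsucc (p : ℕ) : PowerSeries.coeff (p + 1) (PowerSeries.mk H * (1 - PowerSeries.X)) =
      H (p + 1) - H p := by
    rw [mul_sub, mul_one, map_sub, PowerSeries.coeff_succ_mul_X, PowerSeries.coeff_mk,
      PowerSeries.coeff_mk]
  set A := PowerSeries.mk H * (1 - PowerSeries.X)
  let F := PowerSeries.trunc (M + 1) A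
  have hF (p : ℕ) : F.coeff p = PowerSeries.coeff p A := by
    rw [PowerSeries.coeff_trunc]
    split_ifs with h
    · rfl
    · obtain ⟨p, rfl⟩ : ∃ p', p = p' + 1 := ⟨p - 1, by omega⟩
      rw [hsucc, hM p (by omega), sub_self]
  have hsum (p : ℕ) : ∑ i ∈ Finset.range (p + 1), F.coeff i = H p := by
    induction p with
    | zero => rw [Finset.sum_range_one, hF, h0]
    | succ p ih => rw [Finset.sum_range_succ, ih, hF, hsucc]; ring
  have hconst (p : ℕ) (hp : M ≤ p) : H p = H M := by
    induction p, hp using Nat.le_induction with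
    | base => rfl
    | succ p hp ih => rw [hM p hp, ih]
  have hconst' (p : ℕ) (hp : F.natDegree ≤ p) : H p = H F.natDegree := by
    induction p, hp using Nat.le_induction with
    | base => rfl
    | succ p hp ih =>
      have h := hsucc p
      rw [← hF, Polynomial.coeff_eq_zero_of_natDegree_lt (by omega)] at h
      rw [← ih]
      linarith
  have hdeg : H F.natDegree = H M :=
    (hconst' _ (le_max_right M _)).symm.trans (hconst _ (le_max_left _ _))
  have heval : F.eval 1 = H M := by
    rw [Polynomial.eval_eq_sum_range]
    simp only [one_pow, mul_one]
    rw [hsum, hdeg]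
  refine ⟨F, heval ▸ hne, ?_, fun p hp => (hconst' p hp).trans hdeg, fun m hm h => ?_⟩
  · ext p
    rw [Polynomial.coeff_coe, hF]
  · have h1 := hsucc m
    -- The leading coefficient of `F` is the last jump of `H`; were it zero, `F` would vanish,
    -- against `F(1) ≠ 0`.
    rw [← hF, ← hm, hdeg, h, sub_self] at h1
    have h2 : F = 0 := Polynomial.leadingCoeff_eq_zero.1 h1
    rw [h2, Polynomial.eval_zero] at heval
    exact hne heval.symm

/-- If `W` is saturated, then the annihilator of `f_0` modulo `W` is the annihilator of the
saturation of `J = W + (f_0)` modulo `W`. -/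
theorem mul_mem_iff_forall_saturation {f : Fin (n + 1) → S K n} (hW : IsSat (idealW f))
    {h : S K n} :
    f 0 * h ∈ idealW f ↔ ∀ t ∈ saturation (idealJ f), h * t ∈ idealW f := by
  constructor
  · intro h0 t ht
    have hJ : idealJ f ≤ (idealW f).colon {h} := by
      rw [idealJ, Ideal.span_le]
      rintro _ ⟨i, rfl⟩
      rw [SetLike.mem_coe, Submodule.mem_colon_singleton]
      induction i using Fin.cases with
      | zero => exact h0
      | succ i => exact (idealW f).mul_mem_right _ (Ideal.subset_span ⟨i, rfl⟩)
    obtain ⟨k, hk⟩ := ht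
    have key : ∀ k : ℕ, ∀ x : S K n, (∀ u ∈ irrelevant K n ^ k, u * x ∈ idealW f) →
        x ∈ idealW f := by
      intro k
      induction k with
      | zero =>
        intro x hx
        simpa using hx 1 (by simp)
      | succ k ih =>
        intro x hx
        refine hW x fun i => ih _ fun u hu => ?_
        rw [← mul_assoc]
        refine hx _ ?_
        rw [pow_succ]
        exact Ideal.mul_mem_mul hu (Ideal.subset_span ⟨i, rfl⟩)
    -- The ideal `W : h` contains `J`, so `t * m^k ⊆ J` gives `m^k * (h * t) ⊆ W`, and `W` is
    -- saturated.
    refine key k _ fun u hu => ?_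
    have h1 := Submodule.mem_colon_singleton.1 (hJ (hk u hu))
    rwa [smul_eq_mul, show t * u * h = u * (h * t) by ring] at h1
  · intro H
    rw [mul_comm]
    exact H _ (le_saturation _ (Ideal.subset_span ⟨0, rfl⟩))

theorem idealW_le_idealJ (f : Fin (n + 1) → S K n) : idealW f ≤ idealJ f :=
  Ideal.span_mono (by rintro _ ⟨i, rfl⟩; exact ⟨i.succ, rfl⟩)

theorem exists_numerator {d : Fin (n + 1) → ℕ} {f : Fin (n + 1) → S K n}
    (hd : ∀ i, f i ∈ forms K n (d i)) (hreg : IsRegSeq fun i : Fin n => f i.succ)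
    (htop : idealW f ≠ ⊤) (hdim : ¬ ringKrullDim (S K n ⧸ idealJ f) ≤ 0) {s : ℤ}
    (hs : s = (∑ i : Fin n, (d i.succ : ℤ)) - n - 1) :
    ∃ F : Polynomial ℤ, F.eval 1 ≠ 0 ∧
      hilbertSeries (saturation (idealJ f)) * (1 - PowerSeries.X) = (F : PowerSeries ℤ) ∧
      (∀ j : ℤ, j ≤ s - F.natDegree →
        ∀ h ∈ forms K n j, f 0 * h ∈ idealW f → h ∈ idealW f) ∧
      ¬ ∀ h ∈ forms K n (s - F.natDegree + 1), f 0 * h ∈ idealW f → h ∈ idealW f := by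
  have hdW (i : Fin n) : f i.succ ∈ forms K n (d i.succ) := hd i.succ
  have hpos := hreg.degree_pos hdW htop
  have hWsat : IsSat (idealW f) :=
    hreg.isSat fun i => mem_irrelevant_of_mem_forms (by exact_mod_cast hpos i) (hdW i)
  set I := saturation (idealJ f)
  have hIh : Homog I := (homog_span_range hd).saturation
  have hIsat : IsSat I := isSat_saturation _
  have hWI : idealW f ≤ I := (idealW_le_idealJ f).trans (le_saturation _)
  have hne (q : ℕ) : hilb I q ≠ 0 := fun h => hdim (ringKrullDim_le_zero_of_hilb h)
  obtain ⟨F, hF1, hF, hFge, hFlt⟩ := exists_polynomial_of_eventually_const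
    (fun p : ℕ => (hilb I p : ℤ)) (M := (s + 1).toNat)
    (fun p hp => by
      have := hreg.hilb_succ hdW hpos hs hIh hIsat hWI (q := p) (by omega)
      push_cast
      exact_mod_cast this)
    (by exact_mod_cast hne _)
  set c := hilb I ((s + 1).toNat : ℕ)
  have hge (q : ℤ) (hq : F.natDegree ≤ q) : hilb I q = c := by
    lift q to ℕ using by omega
    exact_mod_cast hFge q (by omega)
  -- When `deg F = 0` the degree is `-1`, where the Hilbert function is `0`, while `c ≠ 0` because
  -- `S/J` has positive dimension.
  have hlt : hilb I (F.natDegree - 1 : ℤ) ≠ c := by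
    rcases hm : F.natDegree with _ | m
    · rw [hilb_of_neg I (by simp)]
      exact (hne _).symm
    · have := hFlt m hm
      push_cast
      rw [add_sub_cancel_right]
      exact_mod_cast this
  have hiff (j : ℤ) : (∀ h ∈ forms K n j, f 0 * h ∈ idealW f → h ∈ idealW f) ↔
      hilb I (s - j) = c := by
    obtain ⟨E, hE⟩ := hreg.link_iff hdW hpos hs hIh hWI j
    obtain ⟨N₀, hN₀⟩ := hWsat.exists_form_NZD hIsat
    -- The last summand makes `s + e - j ≥ deg F`, so the Hilbert function there has its eventual
    -- value `c`.
    obtain ⟨l, hl, hlW, hlI⟩ := hN₀ (N₀ + E + (F.natDegree + j - s).toNat) (by omega)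
    have h1 := hE _ (by omega) l hl hlW hlI
    rw [hge _ (by push_cast; omega), eq_comm (a := c)] at h1
    rw [← h1]
    exact forall₂_congr fun h _ => imp_congr_left (mul_mem_iff_forall_saturation hWsat)
  refine ⟨F, hF1, hF, fun j hj => (hiff j).2 (hge _ (by omega)), fun h => hlt ?_⟩
  have := (hiff _).1 h
  rwa [show s - (s - (F.natDegree : ℤ) + 1) = F.natDegree - 1 by ring] at this

end

end ACI

/-! ### The theorem -/

theorem corollary1p6 {K : Type*} [Field K] (n : ℕ) (d : Fin (n + 1) → ℕ)
    (f : Fin (n + 1) → ACI.S K n) (hf : ∀ i, (f i).IsHomogeneous (d i))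
    (hdim : ringKrullDim (ACI.S K n ⧸ ACI.idealJ f) = 1)
    (hreg : RingTheory.Sequence.IsRegular (ACI.S K n) (List.ofFn fun i : Fin n => f i.succ))
    (s : ℤ) (hs : s = (∑ i : Fin n, (d i.succ : ℤ)) - n - 1) :
    (∃ e : ACI.ER f ≃ₗ[ACI.S K n] LinearMap.ker (ACI.mulQuot (ACI.idealW f) (f 0)),
      (∀ a : ACI.AR f,
        (e (Submodule.Quotient.mk a) : ACI.S K n ⧸ ACI.idealW f) =
          Ideal.Quotient.mk (ACI.idealW f) (a.1 0)) ∧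
      ∀ j : ℤ, e '' ACI.ERpiece d f (j + d 0) = ACI.kerPiece f j) ∧
    ∃ F : Polynomial ℤ, F.eval 1 ≠ 0 ∧
      ACI.hilbertSeries (ACI.saturation (ACI.idealJ f)) * (1 - PowerSeries.X) =
        (F : PowerSeries ℤ) ∧
      (∀ j : ℤ, j ≤ s - F.natDegree →
        Function.Injective (ACI.mulForm (ACI.idealW f) (hf 0) j)) ∧
      ¬ Function.Injective (ACI.mulForm (ACI.idealW f) (hf 0) (s - F.natDegree + 1)) ∧
      IsLeast {m : ℤ | ∃ a ∈ ACI.ARpiece d f m, (a : Fin (n + 1) → ACI.S K n) ∉ ACI.KR f}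
        ((∑ i, (d i : ℤ)) - n - F.natDegree) := by
  have hd : ∀ i, f i ∈ ACI.forms K n (d i) := fun i => ACI.mem_forms_natCast.2 (hf i)
  have hseq : ACI.IsRegSeq fun i : Fin n => f i.succ :=
    (ACI.isWeaklyRegular_ofFn_iff _).1 hreg.toIsWeaklyRegular
  have htop : ACI.idealW f ≠ ⊤ := fun h => hreg.top_ne_smul <| by
    rw [ACI.ofList_ofFn, smul_eq_mul, Ideal.mul_top]
    exact h.symm
  refine ⟨⟨ACI.essentialEquiv hseq, ACI.coe_essentialEquiv_mk hseq,
    ACI.essentialEquiv_image_ERpiece hd hseq⟩, ?_⟩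
  obtain ⟨F, hF1, hF, hinj, hninj⟩ := ACI.exists_numerator hd hseq htop
    (by rw [hdim]; exact not_le.2 zero_lt_one) hs
  -- The minimal relation degree is the first degree of noninjectivity shifted by `d 0`, as `a 0`
  -- has degree `m - d 0`.
  have hdeg : (∑ i, (d i : ℤ)) - n - F.natDegree = s - F.natDegree + 1 + d 0 := by
    rw [Fin.sum_univ_succ, hs]
    ring
  refine ⟨F, hF1, hF, fun j hj => (ACI.mulForm_injective_iff _ _).2 (hinj j hj),
    fun h => hninj ((ACI.mulForm_injective_iff _ _).1 h), ?_, ?_⟩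
  · push Not at hninj
    obtain ⟨h, hh, hfh, hhW⟩ := hninj
    obtain ⟨a, ha, rfl⟩ := ACI.exists_ARpiece_of_mul_mem hd hh hfh
    exact ⟨a, hdeg ▸ ha, fun hKR => hhW ((ACI.mem_KR_iff hseq a.2).1 hKR)⟩
  · rintro m ⟨a, ha, haKR⟩
    by_contra! hlt
    exact haKR ((ACI.mem_KR_iff hseq a.2).2 (hinj (m - d 0) (by omega) _ (ha 0)
      (ACI.mul_apply_zero_mem_idealW a.2)))
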